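/- **Model.** Time is slotted. A wireless network has $N$ nodes (set $\mathcal N$), a set $\mathcal L$ of directed links and a nonempty set $\mathcal F$ of $K$ flows; flow $c$ has a source node $b(c)$ and a destination node $d(c)\neq b(c)$, and $s(c)$ denotes its transport layer. In slot $t$ the link rates satisfy $\mu^c_{mn}(t)\in\{0,1\}$ for $(m,n)\in\mathcal L$ (rates are $0$ where there is no link), the admitted rates satisfy $0\le\mu^c_{s(c)b(c)}(t)\le\mu_M$ with a constant $\mu_M\ge1$, nothing is looped back to the source, $\sum_{m\in\mathcal N}\mu^c_{mb(c)}(t)=0$, and each node takes part in at most one transmission, $\sum_{c}\big[\sum_{i\in\mathcal N}\mu^c_{ni}(t)+\sum_{j\in\mathcal N}\mu^c_{jn}(t)\big]\le1$ for all $n\in\mathcal N$. The backlogs $U^c_n(t)$ are nonnegative integers (numbers of packets) with $U^c_n(0)=0$, $U^c_{d(c)}(t)=0$ and, for $n\ne d(c)$, with $[x]^+=\max\{x,0\}$, $$U^c_n(t+1)\le\Big[U^c_n(t)-\sum_{i\in\mathcal N}\mu^c_{ni}(t)\Big]^++\sum_{j\in\mathcal N}\mu^c_{jn}(t)+\mathbf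 1_{\{n=b(c)\}}\,\mu^c_{s(c)b(c)}(t).$$ For virtual input rates $R_c(t)\in[0,\mu_M]$, minimum data rates $a_c\ge0$ and delay thresholds $\rho_c$, the virtual queues start from $0$ and obey $$U^c_{s(c)}(t+1)=[U^c_{s(c)}(t)-\mu^c_{s(c)b(c)}(t)]^++R_c(t),\qquad Z_c(t+1)=[Z_c(t)-R_c(t)]^++a_c,$$ $$X_c(t+1)=[X_c(t)-\rho_cR_c(t)]^++\sum_{n\in\mathcal N}U^c_n(t).$$ **Algorithm with information delayed by $T\ge0$ slots** (control parameters $q_M$ and $V>0$; delayed values at negative times are $0$). *Congestion controller:* $R_c(t)$ minimizes, over $x\in[0,\mu_M]$, $$x\Big(\tfrac{(q_M-\mu_M)U^c_{s(c)}(t)}{q_M}-X_c(t-T)\rho_c-Z_c(t)-V\Big).$$ *Scheduling:* put $$w^c_{mn}(t)=\tfrac{U^c_{s(c)}(t-T)}{q_M}\,[U^c_m(t)-U^c_n(t)]\ \text{ for }(m,n)\in\mathcal L,\ n\neq b(c),\qquad w^c_{s(c)b(c)}(t)=\tfrac{U^c_{s(c)}(t)}{q_M}\,[q_M-\mu_M-U^c_{b(c)}(t)],$$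 and $w^c_{mn}(t)=0$ otherwise. For each pair $(m,n)$ choose a flow $c^*_{mn}(t)\in\arg\max_cw^c_{mn}(t)$ and put $w_{mn}(t)=[\max_cw^c_{mn}(t)]^+$. The decision maximizes $\sum_{m,n}\mu^{c^*_{mn}(t)}_{mn}(t)\,w_{mn}(t)$, where the sum includes the pairs $(s(c),b(c))$, under the constraints above and $\mu^c_{mn}(t)=0$ for $c\ne c^*_{mn}(t)$; moreover $\mu^c_{mn}(t)=0$ for all $c$ whenever $w_{mn}(t)=0$. **Target rates.** Let $\Lambda$ be the capacity region: the set of rate vectors $(z_c)$ for which some random integer packet arrivals with average rates $z_c$ at the nodes $b(c)$ and some scheduling obeying the link constraints keep every node queue stable, i.e. $\limsup_t\frac1t\sum_{\tau<t}\mathbb E\{U^c_n(\tau)\}<\infty$, when the packets actually transmitted (never more than the scheduled rates or the backlog) are exactly conserved and leave the network at $d(c)$. For $\epsilon>0$ let $(r^*_{\epsilon,c})$ maximize $\sum_cr_c$ subject to $(r_c+\epsilon)\in\Lambda$ and $r_c\ge a_c$ for all $c$. Assume that $\epsilon'>0$ satisfies $r^*_{\epsilon,c}\ge a_c+\epsilon'$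 for all $c$. **Theorem 4.** Suppose that $$q_M>\frac{2N-1+\mu_M^2}{2\epsilon}+\mu_M\qquad\text{and}\qquad\rho_c>\frac{Nq_M}{r^*_{\epsilon,c}}\quad\forall c\in\mathcal F.$$ Put $$B=\tfrac12NKq_M\mu_M+K\tfrac{q_M-\mu_M}{q_M}\mu_M^2+\tfrac12\mu_M^2\sum_c\rho_c^2+\tfrac12KN^2q_M^2+\tfrac12K\mu_M^2+\tfrac12K\sum_ca_c^2,$$ $$B_3=B+KN\mu_MT+Nq_MT\mu_M\max_c\rho_c+\mu_M^2T\sum_c\rho_c^2.$$ Then in every evolution of the network under this algorithm (on any probability space) $R_c(t)$, $U^c_{s(c)}(t)$, $X_c(t)$ and $Z_c(t)$ are integrable, and the following hold. (i) $\limsup_t\frac1t\sum_{\tau=0}^{t-1}\sum_c\mathbb E\{R_c(\tau)\}\le K\mu_M$. There is an $\epsilon_1>0$ with $$\epsilon_1\le\rho_cr^*_{\epsilon,c}-Nq_M\ \ \forall c\qquad\text{and}\qquad\epsilon_1\le\frac{\epsilon(q_M-\mu_M)-\frac{2N-1+\mu_M^2}{2}}{q_M}.$$ For each such $\epsilon_1$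 and each $B_R\ge\limsup_t\frac1t\sum_{\tau=0}^{t-1}\sum_c\mathbb E\{R_c(\tau)\}$, with $\delta=\min\{\epsilon_1,\epsilon'\}$ and $B_4=B_3+VB_R$, $$\limsup_{t\to\infty}\frac1t\sum_{\tau=0}^{t-1}\sum_{c\in\mathcal F}\mathbb E\{U^c_{s(c)}(\tau)+X_c(\tau)+Z_c(\tau)\}\le\frac{B_4}{\delta}.$$ (ii) The throughput satisfies $$\liminf_{t\to\infty}\frac1t\sum_{\tau=0}^{t-1}\sum_{c\in\mathcal F}\mathbb E\{R_c(\tau)\}\ge\sum_{c\in\mathcal F}r^*_{\epsilon,c}-\frac{B_3}{V}.$$ -/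

import Mathlib

open MeasureTheory Filter Topology

namespace MultiHop

noncomputable section

/-- A multi-hop network with directed links `links`; flow `c` enters the network layer at the node
`src c` (written `b(c)` in the literature) and leaves it at the node `dst c`. -/
structure Network (Node Flow : Type*) where
  links : Finset (Node × Node)
  src : Flow → Node
  dst : Flow → Node
  src_ne_dst : ∀ c, src c ≠ dst c

/-- The control and quality-of-service parameters: maximal admitted rate `muM`, queue-length
parameter `qM`, throughput parameter `V`, delay thresholds `rho c`, minimum data rates `a c`,
and the delay `T` (in slots) of the queue information. -/
structure Params (Flow : Type*) where
  muM : ℝ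
  qM : ℝ
  V : ℝ
  rho : Flow → ℝ
  a : Flow → ℝ
  T : ℕ

variable {Node Flow : Type*} [Fintype Node] [DecidableEq Node] [Fintype Flow]

/-- Constraints on the link rates `mu m n c` of one slot: a rate is `0` or `1` (and `0` where there
is no link), no packet of a flow is sent back to the source node of this flow, and each node takes
part in at most one transmission (node-exclusive interference model). -/
structure LinkFeasible (G : Network Node Flow) (mu : Node → Node → Flow → ℝ) : Prop where
  zero_or_one : ∀ m n c, mu m n c = 0 ∨ mu m n c = 1
  off_links : ∀ m n c, (m, n) ∉ G.links → mu m n c = 0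
  no_return : ∀ c, ∑ m, mu m (G.src c) c = 0
  node_exclusive : ∀ n, ∑ c, (∑ i, mu n i c + ∑ j, mu j n c) ≤ 1

/-- Constraints on all decisions of one slot: the link rates `mu` and the rates `adm c` at which
packets are admitted from the transport layer to the source nodes. -/
structure Feasible (G : Network Node Flow) (muM : ℝ) (mu : Node → Node → Flow → ℝ)
    (adm : Flow → ℝ) : Prop where
  link : LinkFeasible G mu
  adm_nonneg : ∀ c, 0 ≤ adm c
  adm_le : ∀ c, adm c ≤ muM

/-- The time average `(1/t) ∑_{τ<t} f τ`, as an extended real. -/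
def timeAvg (f : ℕ → ℝ) (t : ℕ) : EReal := (((∑ τ ∈ Finset.range t, f τ) / t : ℝ) : EReal)

/-- `z` is an admissible arrival rate vector: packets `A` arriving with average rates `z` can be
scheduled so that all node queues `U` are stable. Here `mu` are the scheduled link rates and `p` the
numbers of packets actually transmitted, which exceed neither the scheduled rates nor the backlog;
a packet that reaches its destination leaves the network. -/
def Admissible (G : Network Node Flow) (z : Flow → ℝ) : Prop :=
  ∃ (Ω : Type) (_ : MeasurableSpace Ω) (P : Measure Ω) (A : ℕ → Flow → Ω → ℕ)
    (mu : ℕ → Node → Node → Flow → Ω → ℝ) (p : ℕ → Node → Node → Flow → Ω → ℕ)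
    (U : ℕ → Node → Flow → Ω → ℕ),
    IsProbabilityMeasure P ∧
    (∀ t c, Integrable (fun ω => (A t c ω : ℝ)) P) ∧
    (∀ t c, Measurable (A t c)) ∧
    (∀ t m n c, Measurable (mu t m n c)) ∧
    (∀ t m n c, Measurable (p t m n c)) ∧
    (∀ t n c, Measurable (U t n c)) ∧
    (∀ c, Tendsto (fun t : ℕ => (∑ τ ∈ Finset.range t, ∫ ω, (A τ c ω : ℝ) ∂P) / t)
      atTop (𝓝 (z c))) ∧
    (∀ t ω, LinkFeasible G (fun m n c => mu t m n c ω)) ∧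
    (∀ t m n c ω, (p t m n c ω : ℝ) ≤ mu t m n c ω) ∧
    (∀ t n c ω, ∑ i, p t n i c ω ≤ U t n c ω) ∧
    (∀ n c ω, U 0 n c ω = 0) ∧
    (∀ t c ω, U t (G.dst c) c ω = 0) ∧
    (∀ t n c ω, n ≠ G.dst c → U (t + 1) n c ω
      = U t n c ω - ∑ i, p t n i c ω + ∑ j, p t j n c ω
        + (if n = G.src c then A t c ω else 0)) ∧
    (∀ n c, limsup (timeAvg fun t => ∫ ω, (U t n c ω : ℝ) ∂P) atTop < ⊤)

/-- The capacity region: all admissible arrival rate vectors. -/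
def capacityRegion (G : Network Node Flow) : Set (Flow → ℝ) := {z | Admissible G z}

/-- `r` solves: maximize `∑ c, r c` subject to `(r c + ε) ∈ Λ` and `a c ≤ r c` for all `c`. -/
structure IsEpsOptimal (G : Network Node Flow) (a : Flow → ℝ) (ε : ℝ) (r : Flow → ℝ) : Prop where
  mem : (fun c => r c + ε) ∈ capacityRegion G
  ge : ∀ c, a c ≤ r c
  le : ∀ r' : Flow → ℝ, (fun c => r' c + ε) ∈ capacityRegion G → (∀ c, a c ≤ r' c) →
    ∑ c, r' c ≤ ∑ c, r c

/-- The value of the process `q` seen `T` slots later; nothing is queued before slot `0`. -/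
def delayed (T : ℕ) (q : ℕ → ℝ) (t : ℕ) : ℝ := if T ≤ t then q (t - T) else 0

/-- The weight of the link `(m, n)` for the flow `c`, where `Vd c` is the (delayed) virtual queue of
flow `c` at the transport layer. It is `0` if flow `c` may not use the link. -/
def linkWeight (G : Network Node Flow) (qM : ℝ) (Vd : Flow → ℝ) (U : Node → Flow → ℕ)
    (m n : Node) (c : Flow) : ℝ :=
  haveI := Classical.decEq (Node × Node)
  if (m, n) ∈ G.links ∧ n ≠ G.src c then Vd c / qM * ((U m c : ℝ) - U n c) else 0

/-- The weight of the admission of flow `c` from the transport layer to its source node. -/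
def admWeight (G : Network Node Flow) (qM muM : ℝ) (Us : Flow → ℝ) (U : Node → Flow → ℕ)
    (c : Flow) : ℝ :=
  Us c / qM * (qM - muM - U (G.src c) c)

/-- `(mu, adm)` is a decision of the scheduling policy for the link weights `w` and the admission
weights `v`: each link `(m, n)` gets a candidate flow `cs m n` of maximal weight, only candidates
may be transmitted, the total weight is maximal under the constraints of the network, and nothing is
scheduled where the (positive part of the) maximal weight is zero. -/
def IsMaxWeight (G : Network Node Flow) (muM : ℝ) (w : Node → Node → Flow → ℝ) (v : Flow → ℝ)
    (mu : Node → Node → Flow → ℝ) (adm : Flow → ℝ) : Prop :=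
  ∃ cs : Node → Node → Flow,
    (∀ m n c, w m n c ≤ w m n (cs m n)) ∧
    Feasible G muM mu adm ∧
    (∀ m n c, c ≠ cs m n → mu m n c = 0) ∧
    (∀ mu' adm', Feasible G muM mu' adm' → (∀ m n c, c ≠ cs m n → mu' m n c = 0) →
      ∑ m, ∑ n, mu' m n (cs m n) * max (w m n (cs m n)) 0 + ∑ c, adm' c * max (v c) 0
        ≤ ∑ m, ∑ n, mu m n (cs m n) * max (w m n (cs m n)) 0 + ∑ c, adm c * max (v c) 0) ∧
    (∀ m n, max (w m n (cs m n)) 0 = 0 → ∀ c, mu m n c = 0) ∧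
    (∀ c, max (v c) 0 = 0 → adm c = 0)

/-- A random evolution of the controlled network over a sample space `Ω`: node backlogs `U`
(numbers of packets), link rates `mu`, admitted rates `adm`, virtual input rates `R`, and the virtual
queues `Us` (transport layer), `X` (delay) and `Z` (service). -/
structure Evolution (Node Flow Ω : Type*) where
  U : ℕ → Node → Flow → Ω → ℕ
  mu : ℕ → Node → Node → Flow → Ω → ℝ
  adm : ℕ → Flow → Ω → ℝ
  R : ℕ → Flow → Ω → ℝ
  Us : ℕ → Flow → Ω → ℝ
  X : ℕ → Flow → Ω → ℝ
  Z : ℕ → Flow → Ω → ℝ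

/-- The evolution `E` follows the algorithm with delayed queue information. The node queues obey the
usual dynamics with inequality (a scheduled transmission may lack packets). The congestion controller
uses `X` delayed by `T` slots; the link weights use `Us` delayed by `T` slots. -/
structure FollowsDelayedAlg {Ω : Type*} [MeasurableSpace Ω] (G : Network Node Flow)
    (p : Params Flow) (E : Evolution Node Flow Ω) : Prop where
  measurable_U : ∀ t n c, Measurable (E.U t n c)
  measurable_mu : ∀ t m n c, Measurable (E.mu t m n c)
  measurable_adm : ∀ t c, Measurable (E.adm t c)
  measurable_R : ∀ t c, Measurable (E.R t c)
  U_zero : ∀ n c ω, E.U 0 n c ω = 0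
  Us_zero : ∀ c ω, E.Us 0 c ω = 0
  X_zero : ∀ c ω, E.X 0 c ω = 0
  Z_zero : ∀ c ω, E.Z 0 c ω = 0
  U_dst : ∀ t c ω, E.U t (G.dst c) c ω = 0
  U_succ : ∀ t n c ω, n ≠ G.dst c →
    (E.U (t + 1) n c ω : ℝ) ≤ max ((E.U t n c ω : ℝ) - ∑ i, E.mu t n i c ω) 0
      + (∑ j, E.mu t j n c ω + if n = G.src c then E.adm t c ω else 0)
  Us_succ : ∀ t c ω, E.Us (t + 1) c ω = max (E.Us t c ω - E.adm t c ω) 0 + E.R t c ω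
  X_succ : ∀ t c ω, E.X (t + 1) c ω
    = max (E.X t c ω - p.rho c * E.R t c ω) 0 + ∑ n, (E.U t n c ω : ℝ)
  Z_succ : ∀ t c ω, E.Z (t + 1) c ω = max (E.Z t c ω - E.R t c ω) 0 + p.a c
  R_mem : ∀ t c ω, E.R t c ω ∈ Set.Icc 0 p.muM
  R_min : ∀ t c ω, IsMinOn
    (fun x : ℝ => x * ((p.qM - p.muM) * E.Us t c ω / p.qM
      - delayed p.T (fun s => E.X s c ω) t * p.rho c - E.Z t c ω - p.V))
    (Set.Icc 0 p.muM) (E.R t c ω)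
  schedule : ∀ t ω, IsMaxWeight G p.muM
    (linkWeight G p.qM (fun c => delayed p.T (fun s => E.Us s c ω) t) (fun n c => E.U t n c ω))
    (admWeight G p.qM p.muM (fun c => E.Us t c ω) (fun n c => E.U t n c ω))
    (fun m n c => E.mu t m n c ω) (fun c => E.adm t c ω)

/-- The constant `B` of the algorithm without delay, for `N` nodes and `K` flows. -/
def constB (N K : ℝ) (p : Params Flow) : ℝ :=
  1 / 2 * N * K * p.qM * p.muM + K * ((p.qM - p.muM) / p.qM) * p.muM ^ 2
    + 1 / 2 * p.muM ^ 2 * ∑ c, p.rho c ^ 2 + 1 / 2 * K * N ^ 2 * p.qM ^ 2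
    + 1 / 2 * K * p.muM ^ 2 + 1 / 2 * K * ∑ c, p.a c ^ 2

/-- The constant `B₃`: it adds terms linear in `T` to `B`. -/
def constB3 (N K : ℝ) (p : Params Flow) : ℝ :=
  constB N K p + K * N * p.muM * p.T + N * p.qM * p.T * p.muM * (⨆ c, p.rho c)
    + (∑ c, p.rho c ^ 2) * p.muM ^ 2 * p.T

/-- `ε₁` is a common positive lower bound of the slacks in the two conditions on `rho` and `qM`. -/
def IsSlack (N ε : ℝ) (p : Params Flow) (r : Flow → ℝ) (ε₁ : ℝ) : Prop :=
  0 < ε₁ ∧ (∀ c, ε₁ ≤ p.rho c * r c - N * p.qM) ∧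
    ε₁ ≤ (ε * (p.qM - p.muM) - (2 * N - 1 + p.muM ^ 2) / 2) / p.qM

end

end MultiHop

/-! The proof is a Lyapunov drift argument carried out pathwise. Half the sum over the flows of
`flowEnergy` serves as Lyapunov function; its last term couples the node backlogs to the
transport-layer queue, which matches the product form of the link weights.

Three facts make the drift negative. Backlogs never exceed `qM`, because packets move only to
strictly shorter queues and are admitted only below `qM - muM` (`FollowsDelayedAlg.U_le`); so the
input of each `X` is at most `N * qM`, which the condition on `rho` beats. The capacity region
enters by duality: a potential whose differences have weight at most `M` on every schedule also has
weight at most `M` against every admissible rate vector (`Admissible.sum_mul_le`). With the current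
weights as potential, max-weight scheduling dominates the rates `r c + ε` for each sample and slot,
and no randomized policy or conditional expectation is needed. Finally, the congestion controller
does at least as well as the constant rate `r c` (`congestion_le`).

The delay costs only a constant: queues have bounded increments, so a value `T` slots old is wrong
by `O(T)`, and it is multiplied by bounded quantities. The resulting inequality `drift_le` is
telescoped and integrated in `sum_integral_le`; dividing by `t` gives both the queue bound and the
throughput bound. -/

namespace MultiHop

/-! ### Feasible schedules and the dual bound on the capacity region. -/

variable {Node Flow : Type*} [Fintype Node] [Fintype Flow]

namespace LinkFeasible

variable {G : Network Node Flow} {mu : Node → Node → Flow → ℝ}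

lemma nonneg (h : LinkFeasible G mu) (m n : Node) (c : Flow) : 0 ≤ mu m n c := by
  rcases h.zero_or_one m n c with h | h <;> simp [h]

lemma out_nonneg (h : LinkFeasible G mu) (n : Node) (c : Flow) : 0 ≤ ∑ i, mu n i c :=
  Finset.sum_nonneg fun _ _ => h.nonneg _ _ _

lemma in_nonneg (h : LinkFeasible G mu) (n : Node) (c : Flow) : 0 ≤ ∑ j, mu j n c :=
  Finset.sum_nonneg fun _ _ => h.nonneg _ _ _

lemma out_add_in_le_one (h : LinkFeasible G mu) (n : Node) (c : Flow) :
    ∑ i, mu n i c + ∑ j, mu j n c ≤ 1 :=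
  (Finset.single_le_sum (f := fun c => ∑ i, mu n i c + ∑ j, mu j n c)
    (fun c _ => add_nonneg (h.out_nonneg n c) (h.in_nonneg n c)) (Finset.mem_univ c)).trans
    (h.node_exclusive n)

lemma apply_src (h : LinkFeasible G mu) (m : Node) (c : Flow) : mu m (G.src c) c = 0 :=
  (Finset.sum_eq_zero_iff_of_nonneg fun _ _ => h.nonneg _ _ _).1 (h.no_return c) m
    (Finset.mem_univ m)

/-- Each transmission occupies two node slots, one as sender and one as receiver. -/
lemma two_mul_sum_le (h : LinkFeasible G mu) :
    2 * ∑ c, ∑ m, ∑ n, mu m n c ≤ Fintype.card Node := by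
  have h1 : ∑ n, ∑ c, (∑ i, mu n i c + ∑ j, mu j n c) ≤ ∑ _n : Node, (1 : ℝ) :=
    Finset.sum_le_sum fun n _ => h.node_exclusive n
  have h2 : ∑ n, ∑ c, (∑ i, mu n i c + ∑ j, mu j n c) = 2 * ∑ c, ∑ m, ∑ n, mu m n c := by
    rw [Finset.sum_comm, Finset.mul_sum]
    refine Finset.sum_congr rfl fun c _ => ?_
    rw [Finset.sum_add_distrib, two_mul, Finset.sum_comm (f := fun x y => mu y x c)]
  simpa [h2] using h1

/-- Lets bounds over schedules be applied to the packets actually sent. -/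
lemma of_le (h : LinkFeasible G mu) {p : Node → Node → Flow → ℕ}
    (hp : ∀ m n c, (p m n c : ℝ) ≤ mu m n c) : LinkFeasible G fun m n c => (p m n c : ℝ) := by
  refine ⟨fun m n c => ?_, fun m n c hl => ?_, fun c => ?_, fun n => ?_⟩
  · have h1 : (p m n c : ℝ) ≤ 1 := by
      rcases h.zero_or_one m n c with h' | h' <;> linarith [hp m n c]
    have h2 : p m n c ≤ 1 := by exact_mod_cast h1
    interval_cases p m n c <;> simp
  · exact le_antisymm ((hp m n c).trans_eq (h.off_links m n c hl)) (Nat.cast_nonneg _)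
  · exact Finset.sum_eq_zero fun m _ =>
      le_antisymm ((hp m _ c).trans_eq (h.apply_src m c)) (Nat.cast_nonneg _)
  · refine le_trans (Finset.sum_le_sum fun c _ => ?_) (h.node_exclusive n)
    exact add_le_add (Finset.sum_le_sum fun _ _ => hp _ _ _)
      (Finset.sum_le_sum fun _ _ => hp _ _ _)

end LinkFeasible

/-- Summation by parts for a flow on the complete digraph. -/
lemma sum_mul_sub_eq (f : Node → Node → ℝ) (κ : Node → ℝ) :
    ∑ m, ∑ n, f m n * (κ m - κ n) = ∑ n, κ n * (∑ i, f n i - ∑ j, f j n) := by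
  simp only [mul_sub, Finset.sum_sub_distrib, Finset.mul_sum]
  congr 1
  · exact Finset.sum_congr rfl fun m _ => Finset.sum_congr rfl fun n _ => mul_comm _ _
  · rw [Finset.sum_comm]
    exact Finset.sum_congr rfl fun m _ => Finset.sum_congr rfl fun n _ => mul_comm _ _

/-- A sequence with linearly bounded partial sums cannot eventually grow linearly. -/
lemma not_eventually_linear_growth {u : ℕ → ℝ} (hu : ∀ t, 0 ≤ u t) {C η : ℝ} (hη : 0 < η)
    (hC : ∀ᶠ t : ℕ in atTop, ∑ τ ∈ Finset.range t, u τ ≤ C * t) :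
    ¬ ∀ᶠ t : ℕ in atTop, η * t ≤ u t := by
  intro h
  obtain ⟨t₁, h₁⟩ := eventually_atTop.1 hC
  obtain ⟨t₂, h₂⟩ := eventually_atTop.1 h
  obtain ⟨k, hk⟩ := exists_nat_gt (2 * C / η)
  set s := max (max t₁ t₂) (max k 1) with hs
  have hs1 : t₁ ≤ s := (le_max_left _ _).trans (le_max_left _ _)
  have hs2 : t₂ ≤ s := (le_max_right _ _).trans (le_max_left _ _)
  have hs3 : k ≤ s := (le_max_left _ _).trans (le_max_right _ _)
  have hs4 : 1 ≤ s := (le_max_right _ _).trans (le_max_right _ _)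
  -- The terms with index in `[s, 2s)` alone contribute at least `η * s ^ 2`, which exceeds `2 * C *
  -- s` since `s > 2 * C / η`.
  have hu1 := h₁ (s + s) (by omega)
  rw [Finset.sum_range_add] at hu1
  have hu2 : ∑ _i ∈ Finset.range s, η * s ≤ ∑ i ∈ Finset.range s, u (s + i) := by
    refine Finset.sum_le_sum fun i _ => le_trans ?_ (h₂ (s + i) (by omega))
    push_cast
    nlinarith [Nat.cast_nonneg (α := ℝ) i]
  have hu3 : 0 ≤ ∑ i ∈ Finset.range s, u i := Finset.sum_nonneg fun i _ => hu i
  rw [Finset.sum_const, Finset.card_range, nsmul_eq_mul] at hu2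
  have hs5 : (1 : ℝ) ≤ s := by exact_mod_cast hs4
  have hs6 : 2 * C / η < s := hk.trans_le (by exact_mod_cast hs3)
  rw [div_lt_iff₀ hη] at hs6
  push_cast at hu1
  nlinarith

lemma eventually_sum_le_of_limsup_lt_top {f : ℕ → ℝ} (h : limsup (timeAvg f) atTop < ⊤) :
    ∃ C : ℝ, ∀ᶠ t : ℕ in atTop, ∑ τ ∈ Finset.range t, f τ ≤ C * t := by
  obtain ⟨C, hC1, -⟩ := EReal.lt_iff_exists_real_btwn.1 h
  refine ⟨C, ?_⟩
  filter_upwards [eventually_lt_of_limsup_lt hC1, eventually_gt_atTop 0] with t ht h0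
  rw [timeAvg, EReal.coe_lt_coe_iff, div_lt_iff₀ (by exact_mod_cast h0)] at ht
  exact ht.le

variable [DecidableEq Node]

/-- A linear functional of the potential differences that is bounded over all schedules bounds the
admissible arrival rates. -/
theorem Admissible.sum_mul_le {G : Network Node Flow} {z : Flow → ℝ} (hz : Admissible G z)
    {κ : Node → Flow → ℝ} (hκ : ∀ n c, 0 ≤ κ n c) (hκd : ∀ c, κ (G.dst c) c = 0) {M : ℝ}
    (hM : ∀ g, LinkFeasible G g → ∑ c, ∑ m, ∑ n, g m n c * (κ m c - κ n c) ≤ M) :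
    ∑ c, κ (G.src c) c * z c ≤ M := by
  obtain ⟨Ω, _, P, A, mu, p, U, _, hAi, -, -, -, hUm, hA, hmu, hpmu, hpU, hU0, hUd, hUs, hUl⟩ := hz
  have hUi : ∀ t n c, Integrable (fun ω => (U t n c ω : ℝ)) P := by
    -- A node receives at most one packet per slot from its neighbours, besides the exogenous
    -- arrivals.
    have hbd : ∀ t n c ω, (U t n c ω : ℝ) ≤ t + ∑ τ ∈ Finset.range t, (A τ c ω : ℝ) := by
      intro t n c ω
      induction t with
      | zero => simp [hU0]
      | succ t ih =>
        by_cases hn : n = G.dst c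
        · subst hn
          rw [hUd]
          have : 0 ≤ ∑ τ ∈ Finset.range (t + 1), (A τ c ω : ℝ) :=
            Finset.sum_nonneg fun _ _ => Nat.cast_nonneg _
          push_cast
          positivity
        · have hin : (∑ j, (p t j n c ω : ℝ)) ≤ 1 := by
            have hf := (hmu t ω).of_le (p := fun m n c => p t m n c ω)
              fun m n c => hpmu t m n c ω
            linarith [hf.out_add_in_le_one n c, hf.out_nonneg n c]
          have h1 : U (t + 1) n c ω ≤ U t n c ω + ∑ j, p t j n c ω + A t c ω := by
            rw [hUs t n c ω hn]
            split_ifs <;> omega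
          have h2 : (U (t + 1) n c ω : ℝ) ≤ U t n c ω + ∑ j, (p t j n c ω : ℝ) + A t c ω := by
            exact_mod_cast h1
          rw [Finset.sum_range_succ]
          push_cast
          linarith
    intro t n c
    refine Integrable.mono' (g := fun ω => t + ∑ τ ∈ Finset.range t, (A τ c ω : ℝ)) ?_ ?_ ?_
    · exact (integrable_const _).add (integrable_finsetSum _ fun τ _ => hAi τ c)
    · exact (measurable_from_nat.comp (hUm t n c)).aestronglyMeasurable
    · exact Eventually.of_forall fun ω => by simpa using hbd t n c ω
  -- In one slot the stored potential `∑ κ U` gains `κ` at the source per arrival and loses the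
  -- weight of the transmissions, which is at most `M`; leaving at the destination is free as `κ`
  -- vanishes there.
  have hpath : ∀ t ω, ∑ c, κ (G.src c) c * ∑ τ ∈ Finset.range t, (A τ c ω : ℝ)
      ≤ t * M + ∑ c, ∑ n, κ n c * (U t n c ω : ℝ) := by
    intro t ω
    induction t with
    | zero => simp [hU0]
    | succ t ih =>
      have hf := (hmu t ω).of_le (p := fun m n c => p t m n c ω) fun m n c => hpmu t m n c ω
      have h1 := hM _ hf
      have h2 : ∀ c, ∑ m, ∑ n, (p t m n c ω : ℝ) * (κ m c - κ n c)
          = ∑ n, κ n c * (U t n c ω : ℝ) - ∑ n, κ n c * (U (t + 1) n c ω : ℝ)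
            + κ (G.src c) c * A t c ω := by
        intro c
        rw [sum_mul_sub_eq (fun m n => (p t m n c ω : ℝ)) fun n => κ n c]
        have h3 : κ (G.src c) c * (A t c ω : ℝ)
            = ∑ n, κ n c * (if n = G.src c then (A t c ω : ℝ) else 0) := by simp
        rw [h3, ← Finset.sum_sub_distrib, ← Finset.sum_add_distrib]
        refine Finset.sum_congr rfl fun n _ => ?_
        by_cases hn : n = G.dst c
        · subst hn; simp [hκd]
        · have h4 := hUs t n c ω hn
          have h5 := hpU t n c ω
          have h6 : (U (t + 1) n c ω : ℝ) = U t n c ω - ∑ i, (p t n i c ω : ℝ)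
              + ∑ j, (p t j n c ω : ℝ) + (if n = G.src c then (A t c ω : ℝ) else 0) := by
            rw [h4]
            push_cast [Nat.cast_sub h5]
            rfl
          rw [h6]
          ring
      simp only [h2, Finset.sum_add_distrib, Finset.sum_sub_distrib] at h1
      simp only [Finset.sum_range_succ, mul_add, Finset.sum_add_distrib]
      push_cast
      linarith
  set u : ℕ → ℝ := fun t => ∑ c, ∑ n, κ n c * ∫ ω, (U t n c ω : ℝ) ∂P with hu
  have hu0 : ∀ t, 0 ≤ u t := fun t => Finset.sum_nonneg fun c _ => Finset.sum_nonneg fun n _ =>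
    mul_nonneg (hκ n c) (integral_nonneg fun ω => Nat.cast_nonneg _)
  have hmean : ∀ t, ∑ c, κ (G.src c) c * ∑ τ ∈ Finset.range t, ∫ ω, (A τ c ω : ℝ) ∂P
      ≤ t * M + u t := by
    intro t
    have hi1 : ∀ c ∈ Finset.univ, Integrable
        (fun ω => κ (G.src c) c * ∑ τ ∈ Finset.range t, (A τ c ω : ℝ)) P := fun c _ =>
      (integrable_finsetSum _ fun τ _ => hAi τ c).const_mul _
    have hi2 : ∀ c ∈ Finset.univ, Integrable (fun ω => ∑ n, κ n c * (U t n c ω : ℝ)) P :=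
      fun c _ => integrable_finsetSum _ fun n _ => (hUi t n c).const_mul _
    have h1 := integral_mono (μ := P) (integrable_finsetSum _ hi1)
      ((integrable_const (t * M)).add (integrable_finsetSum _ hi2)) (hpath t)
    simp only [Pi.add_apply] at h1
    rw [integral_add (integrable_const _) (integrable_finsetSum _ hi2),
      integral_finsetSum _ hi1, integral_finsetSum _ hi2] at h1
    simp only [integral_const, probReal_univ, one_smul, integral_const_mul] at h1
    have h2 : ∀ c, ∫ ω, ∑ τ ∈ Finset.range t, (A τ c ω : ℝ) ∂P
        = ∑ τ ∈ Finset.range t, ∫ ω, (A τ c ω : ℝ) ∂P := fun c =>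
      integral_finsetSum _ fun τ _ => hAi τ c
    have h3 : ∀ c, ∫ ω, ∑ n, κ n c * (U t n c ω : ℝ) ∂P
        = ∑ n, κ n c * ∫ ω, (U t n c ω : ℝ) ∂P := fun c => by
      rw [integral_finsetSum _ fun n _ => (hUi t n c).const_mul _]
      simp only [integral_const_mul]
    simpa only [h2, h3] using h1
  have hub : ∃ C : ℝ, ∀ᶠ t : ℕ in atTop, ∑ τ ∈ Finset.range t, u τ ≤ C * t := by
    choose C hC using fun n c => eventually_sum_le_of_limsup_lt_top (hUl n c)
    refine ⟨∑ c, ∑ n, κ n c * C n c, ?_⟩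
    have hall : ∀ᶠ t : ℕ in atTop, ∀ n c,
        ∑ τ ∈ Finset.range t, ∫ ω, (U τ n c ω : ℝ) ∂P ≤ C n c * t :=
      eventually_all.2 fun n => eventually_all.2 fun c => hC n c
    filter_upwards [hall] with t ht
    simp only [hu]
    rw [Finset.sum_comm, Finset.sum_mul]
    refine Finset.sum_le_sum fun c _ => ?_
    rw [Finset.sum_comm, Finset.sum_mul]
    refine Finset.sum_le_sum fun n _ => ?_
    rw [← Finset.mul_sum, mul_assoc]
    exact mul_le_mul_of_nonneg_left (ht n c) (hκ n c)
  obtain ⟨C, hC⟩ := hub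
  -- Stability bounds only time averages of `u`, so `u t / t → 0` is not immediate. If the bound
  -- failed, `u` would grow at least linearly, contradicting its linearly bounded partial sums.
  by_contra! hlt
  have hlim : Tendsto (fun t : ℕ => ∑ c, κ (G.src c) c
      * ((∑ τ ∈ Finset.range t, ∫ ω, (A τ c ω : ℝ) ∂P) / t)) atTop
      (𝓝 (∑ c, κ (G.src c) c * z c)) :=
    tendsto_finsetSum _ fun c _ => (hA c).const_mul _
  obtain ⟨y, hy1, hy2⟩ := exists_between hlt
  refine not_eventually_linear_growth hu0 (sub_pos.2 hy1) hC ?_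
  filter_upwards [hlim.eventually (lt_mem_nhds hy2), eventually_gt_atTop 0] with t ht h0
  have h0' : (0 : ℝ) < t := by exact_mod_cast h0
  have h1 := hmean t
  have h2 : ∑ c, κ (G.src c) c * ∑ τ ∈ Finset.range t, ∫ ω, (A τ c ω : ℝ) ∂P
      = t * ∑ c, κ (G.src c) c * ((∑ τ ∈ Finset.range t, ∫ ω, (A τ c ω : ℝ) ∂P) / t) := by
    rw [Finset.mul_sum]
    refine Finset.sum_congr rfl fun c _ => ?_
    field_simp
  nlinarith

/-- The potential is the indicator of the source of `c`: a schedule removes at most one packet per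
slot from that node. -/
lemma Admissible.le_one {G : Network Node Flow} {z : Flow → ℝ} (hz : Admissible G z) (c : Flow) :
    z c ≤ 1 := by
  classical
  have h := hz.sum_mul_le (κ := fun n c' => if n = G.src c ∧ c' = c then 1 else 0) (M := 1)
    (fun n c' => by split_ifs <;> simp)
    (fun c' => if_neg fun h => G.src_ne_dst c (by rw [← h.1, h.2]))
    (fun g hg => by
      simp only [sum_mul_sub_eq (fun m n => g m n _)]
      rw [Finset.sum_eq_single c (fun b _ hb => by simp [hb]) (by simp)]
      simp only [and_true, ite_mul, one_mul, zero_mul, Finset.sum_ite_eq', Finset.mem_univ, if_true]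
      linarith [hg.out_add_in_le_one (G.src c) c, hg.in_nonneg (G.src c) c])
  have h2 : ∑ c', (if G.src c' = G.src c ∧ c' = c then (1 : ℝ) else 0) * z c' = z c := by
    rw [Finset.sum_eq_single c (fun b _ hb => by simp [hb]) (by simp)]
    simp
  linarith

end MultiHop

/-! ### Consequences of max-weight decisions. -/

namespace MultiHop

variable {Node Flow : Type*}

namespace IsMaxWeight

variable [Fintype Node] [Fintype Flow]
variable {G : Network Node Flow} {muM : ℝ} {w : Node → Node → Flow → ℝ} {v : Flow → ℝ}
  {mu : Node → Node → Flow → ℝ} {adm : Flow → ℝ}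

lemma feasible (h : IsMaxWeight G muM w v mu adm) : Feasible G muM mu adm := by
  obtain ⟨_, _, h, _⟩ := h
  exact h

lemma weight_pos (h : IsMaxWeight G muM w v mu adm) {m n : Node} {c : Flow} (hc : mu m n c ≠ 0) :
    0 < w m n c := by
  obtain ⟨cs, -, -, h1, -, h2, -⟩ := h
  have hcs : c = cs m n := by
    by_contra hne
    exact hc (h1 m n c hne)
  by_contra! hw
  exact hc (h2 m n (max_eq_right (hcs ▸ hw)) c)

lemma admWeight_pos (h : IsMaxWeight G muM w v mu adm) {c : Flow} (hc : adm c ≠ 0) :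
    0 < v c := by
  obtain ⟨cs, -, -, -, -, -, h2⟩ := h
  by_contra! hw
  exact hc (h2 c (max_eq_right hw))

/-- Admissions are constrained separately for each flow, so one coordinate can be changed while all
else is kept. -/
lemma mul_le_adm_mul (h : IsMaxWeight G muM w v mu adm) (c : Flow) {x : ℝ} (hx0 : 0 ≤ x)
    (hx : x ≤ muM) : x * v c ≤ adm c * v c := by
  classical
  have hpos := h.admWeight_pos (c := c)
  obtain ⟨cs, -, hf, h1, hmax, -, -⟩ := h
  have h3 := hmax mu (Function.update adm c x)
    ⟨hf.link, fun c' => by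
        by_cases hc : c' = c
        · subst hc; simpa using hx0
        · simpa [hc] using hf.adm_nonneg c',
      fun c' => by
        by_cases hc : c' = c
        · subst hc; simpa using hx
        · simpa [hc] using hf.adm_le c'⟩ h1
  have h4 := le_of_add_le_add_left h3
  rw [← Finset.add_sum_erase _ _ (Finset.mem_univ c),
    ← Finset.add_sum_erase _ (fun c => adm c * max (v c) 0) (Finset.mem_univ c)] at h4
  have h5 : ∑ c' ∈ Finset.univ.erase c, Function.update adm c x c' * max (v c') 0
      = ∑ c' ∈ Finset.univ.erase c, adm c' * max (v c') 0 :=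
    Finset.sum_congr rfl fun c' hc' => by simp [Finset.ne_of_mem_erase hc']
  rw [h5, Function.update_self] at h4
  have h6 := le_of_add_le_add_right h4
  have h7 : adm c * max (v c) 0 = adm c * v c := by
    by_cases hc : adm c = 0
    · simp [hc]
    · rw [max_eq_left (hpos hc).le]
  rw [h7] at h6
  exact (mul_le_mul_of_nonneg_left (le_max_left _ _) hx0).trans h6

/-- A max-weight schedule has at least the weight of every schedule, including those that mix
different flows, if links have no positive weight for flows that may not use them. -/
lemma sum_mul_le (h : IsMaxWeight G muM w v mu adm)
    (hoff : ∀ m n c, (m, n) ∉ G.links → w m n c ≤ 0) (hsrc : ∀ m c, w m (G.src c) c ≤ 0)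
    {g : Node → Node → Flow → ℝ} (hg : LinkFeasible G g) :
    ∑ c, ∑ m, ∑ n, g m n c * w m n c ≤ ∑ c, ∑ m, ∑ n, mu m n c * w m n c := by
  classical
  have hpos := fun m n c => h.weight_pos (m := m) (n := n) (c := c)
  obtain ⟨cs, hcs, hf, h1, hmax, -, -⟩ := h
  -- Each link used by `g` is handed to its candidate flow, or switched off if that flow has
  -- nonpositive weight there. Positive weights occur only on permitted pairs, so feasibility
  -- survives.
  set g' : Node → Node → Flow → ℝ :=
    fun m n c => if c = cs m n ∧ 0 < w m n c then ∑ c', g m n c' else 0 with hg'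
  have hs0 : ∀ m n, 0 ≤ ∑ c, g m n c := fun m n =>
    Finset.sum_nonneg fun c _ => hg.nonneg m n c
  have hs1 : ∀ m n, ∑ c, g m n c ≤ 1 := fun m n =>
    (Finset.sum_le_sum fun c _ => by
      have h2 := Finset.single_le_sum (f := fun i => g m i c) (fun i _ => hg.nonneg m i c)
        (Finset.mem_univ n)
      have h3 := hg.in_nonneg m c
      linarith).trans (hg.node_exclusive m)
  have hs01 : ∀ m n, ∑ c, g m n c = 0 ∨ ∑ c, g m n c = 1 := by
    intro m n
    by_cases hall : ∀ c, g m n c = 0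
    · left; simp [hall]
    · right
      push Not at hall
      obtain ⟨c, hc⟩ := hall
      refine le_antisymm (hs1 m n) ?_
      rw [← (hg.zero_or_one m n c).resolve_left hc]
      exact Finset.single_le_sum (f := fun c => g m n c) (fun c _ => hg.nonneg m n c)
        (Finset.mem_univ c)
  have hg'le : ∀ m n, ∑ c, g' m n c ≤ ∑ c, g m n c := by
    intro m n
    rw [Finset.sum_eq_single (cs m n) (fun c _ hc => by simp [hg', hc]) (by simp)]
    simp only [hg', true_and]
    split_ifs
    · exact le_rfl
    · exact hs0 m n
  have hfeas : LinkFeasible G g' := by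
    refine ⟨fun m n c => ?_, fun m n c hl => ?_, fun c => ?_, fun n => ?_⟩
    · simp only [hg']
      split_ifs
      · exact hs01 m n
      · exact Or.inl rfl
    · exact if_neg fun hh => (hoff m n c hl).not_gt hh.2
    · exact Finset.sum_eq_zero fun m _ => if_neg fun hh => (hsrc m c).not_gt hh.2
    · refine le_trans ?_ (hg.node_exclusive n)
      rw [Finset.sum_add_distrib, Finset.sum_add_distrib]
      refine add_le_add ?_ ?_
      · rw [Finset.sum_comm, Finset.sum_comm (f := fun c i => g n i c)]
        exact Finset.sum_le_sum fun i _ => hg'le n i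
      · rw [Finset.sum_comm, Finset.sum_comm (f := fun c i => g i n c)]
        exact Finset.sum_le_sum fun i _ => hg'le i n
  have h2 := le_of_add_le_add_right (hmax g' adm ⟨hfeas, hf.adm_nonneg, hf.adm_le⟩
    fun m n c hc => if_neg fun hh => hc hh.1)
  have hswap : ∀ f : Node → Node → Flow → ℝ,
      ∑ c, ∑ m, ∑ n, f m n c = ∑ m, ∑ n, ∑ c, f m n c := fun f => by
    rw [Finset.sum_comm]
    exact Finset.sum_congr rfl fun m _ => Finset.sum_comm
  rw [hswap fun m n c => g m n c * w m n c, hswap fun m n c => mu m n c * w m n c]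
  refine le_trans ?_ (h2.trans_eq ?_)
  · refine Finset.sum_le_sum fun m _ => Finset.sum_le_sum fun n _ => ?_
    have h3 : g' m n (cs m n) * max (w m n (cs m n)) 0
        = ∑ c, g m n c * max (w m n (cs m n)) 0 := by
      rw [← Finset.sum_mul]
      simp only [hg', true_and]
      split_ifs with hw
      · rfl
      · rw [max_eq_right (not_lt.1 hw), mul_zero, mul_zero]
    rw [h3]
    exact Finset.sum_le_sum fun c _ => mul_le_mul_of_nonneg_left
      ((hcs m n c).trans (le_max_left _ _)) (hg.nonneg m n c)
  · refine Finset.sum_congr rfl fun m _ => Finset.sum_congr rfl fun n _ => ?_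
    rw [Finset.sum_eq_single (cs m n) (fun c _ hc => by simp [h1 m n c hc]) (by simp)]
    by_cases hc : mu m n (cs m n) = 0
    · simp [hc]
    · rw [max_eq_left (hpos m n _ hc).le]

end IsMaxWeight

section linkWeight

variable [DecidableEq Node]

lemma linkWeight_of_pos {G : Network Node Flow} {qM : ℝ} {Vd : Flow → ℝ} {U : Node → Flow → ℕ}
    {m n : Node} {c : Flow} (h : 0 < linkWeight G qM Vd U m n c) :
    linkWeight G qM Vd U m n c = Vd c / qM * ((U m c : ℝ) - U n c) := by
  unfold linkWeight at h ⊢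
  split_ifs at h ⊢ with h1
  · rfl
  · exact absurd h (lt_irrefl _)

/-- Where the weight is cut off to `0`, a feasible rate is `0` as well, so the cut-off is invisible.
-/
lemma LinkFeasible.mul_linkWeight [Fintype Node] [Fintype Flow] {G : Network Node Flow} {qM : ℝ} {Vd : Flow → ℝ}
    {U : Node → Flow → ℕ} {g : Node → Node → Flow → ℝ} (hg : LinkFeasible G g)
    (m n : Node) (c : Flow) :
    g m n c * linkWeight G qM Vd U m n c = g m n c * (Vd c / qM * U m c - Vd c / qM * U n c) := by
  unfold linkWeight
  split_ifs with h1
  · ring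
  · rw [mul_zero, eq_comm, mul_eq_zero]
    left
    by_cases hl : (m, n) ∈ G.links
    · have hn : n = G.src c := by
        by_contra hn
        exact h1 ⟨hl, hn⟩
      rw [hn]
      exact hg.apply_src m c
    · exact hg.off_links m n c hl

lemma linkWeight_off_links {G : Network Node Flow} {qM : ℝ} {Vd : Flow → ℝ}
    {U : Node → Flow → ℕ} {m n : Node} {c : Flow} (h : (m, n) ∉ G.links) :
    linkWeight G qM Vd U m n c = 0 := if_neg fun h' => h h'.1

lemma linkWeight_src {G : Network Node Flow} {qM : ℝ} {Vd : Flow → ℝ}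
    {U : Node → Flow → ℕ} {m : Node} {c : Flow} :
    linkWeight G qM Vd U m (G.src c) c = 0 := if_neg fun h' => h'.2 rfl

end linkWeight

/-! ### Error of delayed information, and the quadratic queue estimate. -/

lemma delayed_nonneg {q : ℕ → ℝ} (hq : ∀ t, 0 ≤ q t) (T t : ℕ) : 0 ≤ delayed T q t := by
  unfold delayed
  split_ifs
  · exact hq _
  · exact le_rfl

lemma sub_delayed_le {q : ℕ → ℝ} {b : ℝ} (hb : 0 ≤ b) (h0 : q 0 = 0)
    (hq : ∀ t, q (t + 1) ≤ q t + b) (T t : ℕ) : q t - delayed T q t ≤ T * b := by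
  have key : ∀ s k : ℕ, q (s + k) ≤ q s + k * b := by
    intro s k
    induction k with
    | zero => simp
    | succ k ih =>
      have := hq (s + k)
      rw [← add_assoc]
      push_cast
      linarith
  unfold delayed
  split_ifs with h
  · have := key (t - T) T
    rw [Nat.sub_add_cancel h] at this
    linarith
  -- Before slot `T` the delayed value `0` equals `q 0`, and only `t ≤ T` increments separate it
  -- from `q t`.
  · have := key 0 t
    rw [zero_add, h0] at this
    have h2 : (t : ℝ) ≤ T := by exact_mod_cast (not_le.1 h).le
    nlinarith

lemma delayed_sub_le {q : ℕ → ℝ} {b : ℝ} (hb : 0 ≤ b) (h0 : q 0 = 0)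
    (hq : ∀ t, q t - b ≤ q (t + 1)) (T t : ℕ) : delayed T q t - q t ≤ T * b := by
  have h := sub_delayed_le (q := fun t => -q t) hb (by simp [h0])
    (fun t => by linarith [hq t]) T t
  have h2 : delayed T (fun t => -q t) t = -delayed T q t := by
    unfold delayed
    split_ifs <;> simp
  rw [h2] at h
  linarith

lemma sq_queue_step_le {x y z : ℝ} (hx : 0 ≤ x) (hy : 0 ≤ y) (hz : 0 ≤ z) :
    (max (x - y) 0 + z) ^ 2 ≤ x ^ 2 + y ^ 2 + z ^ 2 + 2 * x * (z - y) := by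
  rcases le_total (x - y) 0 with h | h
  · rw [max_eq_right h]
    nlinarith [sq_nonneg (x - y), mul_nonneg hx hz]
  · rw [max_eq_left h]
    nlinarith [mul_nonneg hy hz]

end MultiHop

/-! ### Deterministic queue bounds, measurability and integrability. -/

namespace MultiHop

variable {Node Flow : Type*} [Fintype Node] [DecidableEq Node] [Fintype Flow]

namespace FollowsDelayedAlg

variable {Ω : Type*} [MeasurableSpace Ω] {G : Network Node Flow} {p : Params Flow}
  {E : Evolution Node Flow Ω}

lemma link (hE : FollowsDelayedAlg G p E) (t : ℕ) (ω : Ω) :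
    LinkFeasible G fun m n c => E.mu t m n c ω := (hE.schedule t ω).feasible.link

lemma R_nonneg (hE : FollowsDelayedAlg G p E) (t : ℕ) (c : Flow) (ω : Ω) : 0 ≤ E.R t c ω :=
  (hE.R_mem t c ω).1

lemma R_le (hE : FollowsDelayedAlg G p E) (t : ℕ) (c : Flow) (ω : Ω) : E.R t c ω ≤ p.muM :=
  (hE.R_mem t c ω).2

lemma adm_nonneg (hE : FollowsDelayedAlg G p E) (t : ℕ) (c : Flow) (ω : Ω) : 0 ≤ E.adm t c ω :=
  (hE.schedule t ω).feasible.adm_nonneg c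

lemma adm_le (hE : FollowsDelayedAlg G p E) (t : ℕ) (c : Flow) (ω : Ω) : E.adm t c ω ≤ p.muM :=
  (hE.schedule t ω).feasible.adm_le c

lemma Us_nonneg (hE : FollowsDelayedAlg G p E) (t : ℕ) (c : Flow) (ω : Ω) : 0 ≤ E.Us t c ω := by
  cases t with
  | zero => rw [hE.Us_zero]
  | succ t =>
    rw [hE.Us_succ]
    exact add_nonneg (le_max_right _ _) (hE.R_nonneg t c ω)

lemma X_nonneg (hE : FollowsDelayedAlg G p E) (t : ℕ) (c : Flow) (ω : Ω) : 0 ≤ E.X t c ω := by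
  cases t with
  | zero => rw [hE.X_zero]
  | succ t =>
    rw [hE.X_succ]
    exact add_nonneg (le_max_right _ _) (Finset.sum_nonneg fun n _ => Nat.cast_nonneg _)

lemma Z_nonneg (hE : FollowsDelayedAlg G p E) (ha : ∀ c, 0 ≤ p.a c) (t : ℕ) (c : Flow) (ω : Ω) :
    0 ≤ E.Z t c ω := by
  cases t with
  | zero => rw [hE.Z_zero]
  | succ t =>
    rw [hE.Z_succ]
    exact add_nonneg (le_max_right _ _) (ha c)

lemma Us_succ_le (hE : FollowsDelayedAlg G p E) (t : ℕ) (c : Flow) (ω : Ω) :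
    E.Us (t + 1) c ω ≤ E.Us t c ω + p.muM := by
  rw [hE.Us_succ]
  exact add_le_add (max_le (by linarith [hE.adm_nonneg t c ω]) (hE.Us_nonneg t c ω))
    (hE.R_le t c ω)

lemma le_Us_succ (hE : FollowsDelayedAlg G p E) (t : ℕ) (c : Flow) (ω : Ω) :
    E.Us t c ω - p.muM ≤ E.Us (t + 1) c ω := by
  rw [hE.Us_succ]
  linarith [le_max_left (E.Us t c ω - E.adm t c ω) 0, hE.R_nonneg t c ω, hE.adm_le t c ω]

lemma backlog_lt_of_mu_ne_zero (hE : FollowsDelayedAlg G p E) (hq : 0 < p.qM) {t : ℕ} {m n : Node}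
    {c : Flow} {ω : Ω} (h : E.mu t m n c ω ≠ 0) : E.U t n c ω < E.U t m c ω := by
  have h1 := (hE.schedule t ω).weight_pos h
  have h2 := linkWeight_of_pos h1
  rw [h2] at h1
  have h3 : 0 ≤ delayed p.T (fun s => E.Us s c ω) t / p.qM :=
    div_nonneg (delayed_nonneg (fun s => hE.Us_nonneg s c ω) _ _) hq.le
  have h4 := pos_of_mul_pos_right h1 h3
  exact_mod_cast sub_pos.1 h4

/-- All backlogs in the network are bounded by the queue-length parameter. -/
theorem U_le (hE : FollowsDelayedAlg G p E) (hmu : 0 ≤ p.muM) (hq : p.muM < p.qM) (t : ℕ)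
    (n : Node) (c : Flow) (ω : Ω) : (E.U t n c ω : ℝ) ≤ p.qM := by
  have hq0 : 0 < p.qM := hmu.trans_lt hq
  induction t generalizing n with
  | zero => rw [hE.U_zero]; simpa using hq0.le
  | succ t ih =>
    by_cases hd : n = G.dst c
    · rw [hd, hE.U_dst]; simpa using hq0.le
    have h1 := hE.U_succ t n c ω hd
    have hl := hE.link t ω
    have h2 : max ((E.U t n c ω : ℝ) - ∑ i, E.mu t n i c ω) 0 ≤ E.U t n c ω :=
      max_le (by linarith [hl.out_nonneg n c]) (Nat.cast_nonneg _)
    by_cases hs : n = G.src c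
    · subst hs
      rw [if_pos rfl, hl.no_return c, zero_add] at h1
      by_cases h0 : E.adm t c ω = 0
      · linarith [ih (G.src c)]
      · have h3 := (hE.schedule t ω).admWeight_pos h0
        have h4 : 0 ≤ E.Us t c ω / p.qM := div_nonneg (hE.Us_nonneg t c ω) hq0.le
        have h5 := pos_of_mul_pos_right h3 h4
        linarith [hE.adm_le t c ω]
    · rw [if_neg hs, add_zero] at h1
      by_cases hall : ∀ j, E.mu t j n c ω = 0
      · rw [Finset.sum_eq_zero fun j _ => hall j] at h1
        linarith [ih n]
      · push Not at hall
        obtain ⟨j, hj⟩ := hall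
        -- Integrality of the backlogs turns the strict inequality into a gap of a whole packet,
        -- room for the one that arrives.
        have h3 : (E.U t n c ω : ℝ) + 1 ≤ E.U t j c ω := by
          exact_mod_cast hE.backlog_lt_of_mu_ne_zero hq0 hj
        linarith [ih j, hl.out_add_in_le_one n c, hl.out_nonneg n c]

lemma sum_U_le (hE : FollowsDelayedAlg G p E) (hmu : 0 ≤ p.muM) (hq : p.muM < p.qM) (t : ℕ)
    (c : Flow) (ω : Ω) : ∑ n, (E.U t n c ω : ℝ) ≤ Fintype.card Node * p.qM :=
  (Finset.sum_le_sum fun n _ => hE.U_le hmu hq t n c ω).trans_eq (by simp)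

lemma X_succ_le (hE : FollowsDelayedAlg G p E) (hmu : 0 ≤ p.muM) (hq : p.muM < p.qM)
    (hrho : ∀ c, 0 ≤ p.rho c) (t : ℕ) (c : Flow) (ω : Ω) :
    E.X (t + 1) c ω ≤ E.X t c ω + Fintype.card Node * p.qM := by
  rw [hE.X_succ]
  exact add_le_add (max_le (by linarith [mul_nonneg (hrho c) (hE.R_nonneg t c ω)])
    (hE.X_nonneg t c ω)) (hE.sum_U_le hmu hq t c ω)

lemma le_X_succ (hE : FollowsDelayedAlg G p E) (hrho : ∀ c, 0 ≤ p.rho c) (t : ℕ) (c : Flow)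
    (ω : Ω) : E.X t c ω - p.rho c * p.muM ≤ E.X (t + 1) c ω := by
  rw [hE.X_succ]
  have h1 : (0 : ℝ) ≤ ∑ n, (E.U t n c ω : ℝ) := Finset.sum_nonneg fun n _ => Nat.cast_nonneg _
  linarith [le_max_left (E.X t c ω - p.rho c * E.R t c ω) 0,
    mul_le_mul_of_nonneg_left (hE.R_le t c ω) (hrho c)]

lemma Z_succ_le (hE : FollowsDelayedAlg G p E) (ha : ∀ c, 0 ≤ p.a c) (t : ℕ) (c : Flow) (ω : Ω) :
    E.Z (t + 1) c ω ≤ E.Z t c ω + p.a c := by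
  rw [hE.Z_succ]
  exact add_le_add_left (max_le (by linarith [hE.R_nonneg t c ω]) (hE.Z_nonneg ha t c ω)) _

lemma measurable_Us (hE : FollowsDelayedAlg G p E) (t : ℕ) (c : Flow) :
    Measurable (E.Us t c) := by
  induction t with
  | zero => rw [show E.Us 0 c = fun _ => 0 from funext (hE.Us_zero c)]; exact measurable_const
  | succ t ih =>
    rw [show E.Us (t + 1) c = _ from funext (hE.Us_succ t c)]
    exact ((ih.sub (hE.measurable_adm t c)).max measurable_const).add (hE.measurable_R t c)

lemma measurable_X (hE : FollowsDelayedAlg G p E) (t : ℕ) (c : Flow) :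
    Measurable (E.X t c) := by
  induction t with
  | zero => rw [show E.X 0 c = fun _ => 0 from funext (hE.X_zero c)]; exact measurable_const
  | succ t ih =>
    rw [show E.X (t + 1) c = _ from funext (hE.X_succ t c)]
    exact ((ih.sub ((hE.measurable_R t c).const_mul _)).max measurable_const).add
      (Finset.measurable_fun_sum _ fun n _ => measurable_from_nat.comp (hE.measurable_U t n c))

lemma measurable_Z (hE : FollowsDelayedAlg G p E) (t : ℕ) (c : Flow) :
    Measurable (E.Z t c) := by
  induction t with
  | zero => rw [show E.Z 0 c = fun _ => 0 from funext (hE.Z_zero c)]; exact measurable_const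
  | succ t ih =>
    rw [show E.Z (t + 1) c = _ from funext (hE.Z_succ t c)]
    exact ((ih.sub (hE.measurable_R t c)).max measurable_const).add measurable_const

end FollowsDelayedAlg

lemma le_mul_of_succ_le {q : ℕ → ℝ} {b : ℝ} (h0 : q 0 = 0) (hq : ∀ t, q (t + 1) ≤ q t + b)
    (t : ℕ) : q t ≤ t * b := by
  induction t with
  | zero => simp [h0]
  | succ t ih => push_cast; linarith [hq t]

lemma integrable_of_mem_Icc {Ω : Type*} [MeasurableSpace Ω] {P : Measure Ω} [IsFiniteMeasure P]
    {f : Ω → ℝ} (hf : Measurable f) {b : ℝ} (h0 : ∀ ω, 0 ≤ f ω) (hb : ∀ ω, f ω ≤ b) :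
    Integrable f P :=
  Integrable.mono' (integrable_const b) hf.aestronglyMeasurable
    (Eventually.of_forall fun ω => by rw [Real.norm_of_nonneg (h0 ω)]; exact hb ω)

namespace FollowsDelayedAlg

variable {Ω : Type*} [MeasurableSpace Ω] {G : Network Node Flow} {p : Params Flow}
  {E : Evolution Node Flow Ω}

lemma Us_le (hE : FollowsDelayedAlg G p E) (t : ℕ) (c : Flow) (ω : Ω) :
    E.Us t c ω ≤ t * p.muM :=
  le_mul_of_succ_le (q := fun t => E.Us t c ω) (hE.Us_zero c ω) (fun t => hE.Us_succ_le t c ω) t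

lemma X_le (hE : FollowsDelayedAlg G p E) (hmu : 0 ≤ p.muM) (hq : p.muM < p.qM)
    (hrho : ∀ c, 0 ≤ p.rho c) (t : ℕ) (c : Flow) (ω : Ω) :
    E.X t c ω ≤ t * (Fintype.card Node * p.qM) :=
  le_mul_of_succ_le (q := fun t => E.X t c ω) (hE.X_zero c ω)
    (fun t => hE.X_succ_le hmu hq hrho t c ω) t

lemma Z_le (hE : FollowsDelayedAlg G p E) (ha : ∀ c, 0 ≤ p.a c) (t : ℕ) (c : Flow) (ω : Ω) :
    E.Z t c ω ≤ t * p.a c :=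
  le_mul_of_succ_le (q := fun t => E.Z t c ω) (hE.Z_zero c ω) (fun t => hE.Z_succ_le ha t c ω) t

variable (P : Measure Ω) [IsFiniteMeasure P]

lemma integrable_R (hE : FollowsDelayedAlg G p E) (t : ℕ) (c : Flow) : Integrable (E.R t c) P :=
  integrable_of_mem_Icc (hE.measurable_R t c) (hE.R_nonneg t c) (hE.R_le t c)

lemma integrable_Us (hE : FollowsDelayedAlg G p E) (t : ℕ) (c : Flow) : Integrable (E.Us t c) P :=
  integrable_of_mem_Icc (hE.measurable_Us t c) (hE.Us_nonneg t c) (hE.Us_le t c)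

lemma integrable_X (hE : FollowsDelayedAlg G p E) (hmu : 0 ≤ p.muM) (hq : p.muM < p.qM)
    (hrho : ∀ c, 0 ≤ p.rho c) (t : ℕ) (c : Flow) : Integrable (E.X t c) P :=
  integrable_of_mem_Icc (hE.measurable_X t c) (hE.X_nonneg t c) (hE.X_le hmu hq hrho t c)

lemma integrable_Z (hE : FollowsDelayedAlg G p E) (ha : ∀ c, 0 ≤ p.a c) (t : ℕ) (c : Flow) :
    Integrable (E.Z t c) P :=
  integrable_of_mem_Icc (hE.measurable_Z t c) (hE.Z_nonneg ha t c) (hE.Z_le ha t c)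

end FollowsDelayedAlg

end MultiHop

/-! ### The one-slot drift. -/

namespace MultiHop

variable {Node Flow : Type*} [Fintype Node]

/-- Twice the contribution of the flow `c` to the Lyapunov function. -/
noncomputable def flowEnergy {Ω : Type*} (p : Params Flow) (E : Evolution Node Flow Ω) (t : ℕ)
    (c : Flow) (ω : Ω) : ℝ :=
  (p.qM - p.muM) / p.qM * E.Us t c ω ^ 2 + E.X t c ω ^ 2 + E.Z t c ω ^ 2
    + E.Us t c ω / p.qM * ∑ n, (E.U t n c ω : ℝ) ^ 2

/-- The total weight of the scheduled transmissions of the flow `c`, in terms of differential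
backlogs. -/
noncomputable def servedBacklog {Ω : Type*} (E : Evolution Node Flow Ω) (t : ℕ) (c : Flow)
    (ω : Ω) : ℝ :=
  ∑ m, ∑ n, E.mu t m n c ω * ((E.U t m c ω : ℝ) - E.U t n c ω)

lemma two_le_card_node (G : Network Node Flow) (c : Flow) :
    (2 : ℝ) ≤ Fintype.card Node := by
  have h : 1 < Fintype.card Node := Fintype.one_lt_card_iff.2 ⟨_, _, G.src_ne_dst c⟩
  exact_mod_cast h

variable [DecidableEq Node] [Fintype Flow]

namespace FollowsDelayedAlg

variable {Ω : Type*} [MeasurableSpace Ω] {G : Network Node Flow} {p : Params Flow}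
  {E : Evolution Node Flow Ω}

lemma flowEnergy_nonneg (hE : FollowsDelayedAlg G p E) (hmu : 0 ≤ p.muM) (hq : p.muM < p.qM)
    (t : ℕ) (c : Flow) (ω : Ω) : 0 ≤ flowEnergy p E t c ω := by
  have h0 : 0 < p.qM := hmu.trans_lt hq
  have h1 := hE.Us_nonneg t c ω
  have h2 : 0 ≤ p.qM - p.muM := by linarith
  unfold flowEnergy
  positivity

/-- The squared service and arrivals of a node total at most `2`, and at the source at most `1 + muM
^ 2` because nothing is returned there; this produces `2N - 1 + muM ^ 2`. -/
lemma sum_sq_backlog_succ_le (hE : FollowsDelayedAlg G p E) (t : ℕ) (c : Flow) (ω : Ω) :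
    ∑ n, (E.U (t + 1) n c ω : ℝ) ^ 2 ≤ ∑ n, (E.U t n c ω : ℝ) ^ 2
      + (2 * Fintype.card Node - 1 + p.muM ^ 2)
      - 2 * (servedBacklog E t c ω - E.U t (G.src c) c ω * E.adm t c ω) := by
  have hl := hE.link t ω
  have h1 : ∀ n, (E.U (t + 1) n c ω : ℝ) ^ 2 ≤ (E.U t n c ω : ℝ) ^ 2
      + (2 + if n = G.src c then p.muM ^ 2 - 1 else 0)
      - 2 * ((E.U t n c ω : ℝ) * (∑ i, E.mu t n i c ω - ∑ j, E.mu t j n c ω)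
        - if n = G.src c then (E.U t n c ω : ℝ) * E.adm t c ω else 0) := by
    intro n
    by_cases hd : n = G.dst c
    · have hs : n ≠ G.src c := fun h => G.src_ne_dst c (by rw [← h, hd])
      rw [if_neg hs, if_neg hs, hd, hE.U_dst, hE.U_dst]
      simp
    have ho := hl.out_nonneg n c
    have hi := hl.in_nonneg n c
    have hoi := hl.out_add_in_le_one n c
    have ha := hE.adm_nonneg t c ω
    have hz : 0 ≤ ∑ j, E.mu t j n c ω + if n = G.src c then E.adm t c ω else 0 := by
      split_ifs <;> linarith
    have h2 := pow_le_pow_left₀ (Nat.cast_nonneg _) (hE.U_succ t n c ω hd) 2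
    have h3 := sq_queue_step_le (Nat.cast_nonneg (α := ℝ) (E.U t n c ω)) ho hz
    refine h2.trans (h3.trans ?_)
    by_cases hs : n = G.src c
    · subst hs
      simp only [if_true]
      rw [hl.no_return c, zero_add, sub_zero]
      have h4 := pow_le_pow_left₀ ha (hE.adm_le t c ω) 2
      rw [hl.no_return c] at hoi
      nlinarith
    · simp only [if_neg hs]
      nlinarith
  refine (Finset.sum_le_sum fun n _ => h1 n).trans_eq ?_
  have h5 : servedBacklog E t c ω
      = ∑ n, (E.U t n c ω : ℝ) * (∑ i, E.mu t n i c ω - ∑ j, E.mu t j n c ω) :=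
    sum_mul_sub_eq (fun m n => E.mu t m n c ω) fun n => (E.U t n c ω : ℝ)
  rw [h5, Finset.sum_sub_distrib, Finset.sum_add_distrib, Finset.sum_add_distrib,
    ← Finset.mul_sum, Finset.sum_sub_distrib]
  simp
  ring

/-- The drift of a single flow in one slot. -/
lemma flowEnergy_succ_le (hE : FollowsDelayedAlg G p E) (hmu : 0 ≤ p.muM) (hq : p.muM < p.qM)
    (ha : ∀ c, 0 ≤ p.a c) (hrho : ∀ c, 0 ≤ p.rho c) (t : ℕ) (c : Flow) (ω : Ω) :
    1 / 2 * flowEnergy p E (t + 1) c ω - 1 / 2 * flowEnergy p E t c ω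
      ≤ 1 / 2 * Fintype.card Node * p.qM * p.muM + (p.qM - p.muM) / p.qM * p.muM ^ 2
        + 1 / 2 * p.muM ^ 2 * p.rho c ^ 2 + 1 / 2 * (Fintype.card Node) ^ 2 * p.qM ^ 2
        + 1 / 2 * p.muM ^ 2 + 1 / 2 * p.a c ^ 2
        + (p.qM - p.muM) / p.qM * (E.Us t c ω * (E.R t c ω - E.adm t c ω))
        + E.X t c ω * (∑ n, (E.U t n c ω : ℝ) - p.rho c * E.R t c ω)
        + E.Z t c ω * (p.a c - E.R t c ω)
        + E.Us t c ω / p.qM * ((2 * Fintype.card Node - 1 + p.muM ^ 2) / 2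
          - servedBacklog E t c ω + E.U t (G.src c) c ω * E.adm t c ω) := by
  have hq0 : 0 < p.qM := hmu.trans_lt hq
  have hR0 := hE.R_nonneg t c ω
  have hR2 := pow_le_pow_left₀ hR0 (hE.R_le t c ω) 2
  have hA0 := hE.adm_nonneg t c ω
  have hA2 := pow_le_pow_left₀ hA0 (hE.adm_le t c ω) 2
  have hS0 : (0 : ℝ) ≤ ∑ n, (E.U t n c ω : ℝ) := Finset.sum_nonneg fun n _ => Nat.cast_nonneg _
  have hS2 := pow_le_pow_left₀ hS0 (hE.sum_U_le hmu hq t c ω) 2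
  have hUs : 1 / 2 * ((p.qM - p.muM) / p.qM * E.Us (t + 1) c ω ^ 2)
      - 1 / 2 * ((p.qM - p.muM) / p.qM * E.Us t c ω ^ 2)
      ≤ (p.qM - p.muM) / p.qM * p.muM ^ 2
        + (p.qM - p.muM) / p.qM * (E.Us t c ω * (E.R t c ω - E.adm t c ω)) := by
    have h1 := sq_queue_step_le (hE.Us_nonneg t c ω) hA0 hR0
    rw [← hE.Us_succ] at h1
    have h2 : E.Us (t + 1) c ω ^ 2 - E.Us t c ω ^ 2
        ≤ 2 * (p.muM ^ 2 + E.Us t c ω * (E.R t c ω - E.adm t c ω)) := by linarith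
    have h3 := mul_le_mul_of_nonneg_left h2 (div_nonneg (sub_nonneg.2 hq.le) hq0.le)
    linarith
  have hX : 1 / 2 * E.X (t + 1) c ω ^ 2 - 1 / 2 * E.X t c ω ^ 2
      ≤ 1 / 2 * p.muM ^ 2 * p.rho c ^ 2 + 1 / 2 * (Fintype.card Node) ^ 2 * p.qM ^ 2
        + E.X t c ω * (∑ n, (E.U t n c ω : ℝ) - p.rho c * E.R t c ω) := by
    have h1 := sq_queue_step_le (hE.X_nonneg t c ω) (mul_nonneg (hrho c) hR0) hS0
    rw [← hE.X_succ] at h1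
    have h2 := mul_le_mul_of_nonneg_left hR2 (sq_nonneg (p.rho c))
    rw [mul_pow] at h1 hS2
    linarith
  have hZ : 1 / 2 * E.Z (t + 1) c ω ^ 2 - 1 / 2 * E.Z t c ω ^ 2
      ≤ 1 / 2 * p.muM ^ 2 + 1 / 2 * p.a c ^ 2 + E.Z t c ω * (p.a c - E.R t c ω) := by
    have h1 := sq_queue_step_le (hE.Z_nonneg ha t c ω) hR0 (ha c)
    rw [← hE.Z_succ] at h1
    linarith
  have hU : 1 / 2 * (E.Us (t + 1) c ω / p.qM * ∑ n, (E.U (t + 1) n c ω : ℝ) ^ 2)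
      - 1 / 2 * (E.Us t c ω / p.qM * ∑ n, (E.U t n c ω : ℝ) ^ 2)
      ≤ 1 / 2 * Fintype.card Node * p.qM * p.muM
        + E.Us t c ω / p.qM * ((2 * Fintype.card Node - 1 + p.muM ^ 2) / 2
          - servedBacklog E t c ω + E.U t (G.src c) c ω * E.adm t c ω) := by
    have h1 := mul_le_mul_of_nonneg_left (hE.sum_sq_backlog_succ_le t c ω)
      (div_nonneg (hE.Us_nonneg t c ω) hq0.le)
    have h2 : ∑ n, (E.U (t + 1) n c ω : ℝ) ^ 2 ≤ Fintype.card Node * p.qM ^ 2 :=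
      (Finset.sum_le_sum fun n _ => pow_le_pow_left₀ (Nat.cast_nonneg _)
        (hE.U_le hmu hq (t + 1) n c ω) 2).trans_eq (by simp)
    -- The coefficient also moves, by at most `muM / qM`; against squared backlogs of at most `N *
    -- qM ^ 2` this costs `N * qM * muM / 2`.
    have h3 : E.Us (t + 1) c ω / p.qM ≤ E.Us t c ω / p.qM + p.muM / p.qM := by
      rw [← add_div]
      exact div_le_div_of_nonneg_right (hE.Us_succ_le t c ω) hq0.le
    have h4 : (0 : ℝ) ≤ ∑ n, (E.U (t + 1) n c ω : ℝ) ^ 2 :=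
      Finset.sum_nonneg fun n _ => sq_nonneg _
    have h5 := mul_le_mul_of_nonneg_right h3 h4
    have h6 := mul_le_mul_of_nonneg_left h2 (div_nonneg hmu hq0.le)
    have h7 : p.muM / p.qM * (Fintype.card Node * p.qM ^ 2)
        = Fintype.card Node * p.qM * p.muM := by
      field_simp
    linarith
  unfold flowEnergy
  linarith

/-- The congestion controller, with delayed information about `X`, is almost as good as the constant
input rate `x`. -/
lemma congestion_le (hE : FollowsDelayedAlg G p E) (hmu : 0 ≤ p.muM) (hq : p.muM < p.qM)
    (hrho : ∀ c, 0 ≤ p.rho c) (t : ℕ) (c : Flow) (ω : Ω) {x : ℝ} (hx0 : 0 ≤ x) (hx : x ≤ p.muM)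
    (hxq : Fintype.card Node * p.qM ≤ p.rho c * x) :
    E.R t c ω * ((p.qM - p.muM) / p.qM * E.Us t c ω - p.rho c * E.X t c ω - E.Z t c ω)
      ≤ x * ((p.qM - p.muM) / p.qM * E.Us t c ω - p.rho c * E.X t c ω - E.Z t c ω)
        + p.V * (E.R t c ω - x) + p.rho c ^ 2 * p.muM ^ 2 * p.T := by
  have hq0 : 0 < p.qM := hmu.trans_lt hq
  have h1 := isMinOn_iff.1 (hE.R_min t c ω) x ⟨hx0, hx⟩
  have h2 := delayed_sub_le (q := fun t => E.X t c ω) (mul_nonneg (hrho c) hmu) (hE.X_zero c ω)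
    (fun t => hE.le_X_succ hrho t c ω) p.T t
  have h3 := sub_delayed_le (q := fun t => E.X t c ω)
    (mul_nonneg (Nat.cast_nonneg (Fintype.card Node)) hq0.le) (hE.X_zero c ω)
    (fun t => hE.X_succ_le hmu hq hrho t c ω) p.T t
  set D := delayed p.T (fun s => E.X s c ω) t
  have hT : (0 : ℝ) ≤ p.T := Nat.cast_nonneg _
  have hρμ : 0 ≤ p.rho c * p.muM := mul_nonneg (hrho c) hmu
  have h4 : (E.R t c ω - x) * p.rho c * (D - E.X t c ω) ≤ p.rho c ^ 2 * p.muM ^ 2 * p.T := by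
    have hR0 := hE.R_nonneg t c ω
    have hR1 := hE.R_le t c ω
    have hb : 0 ≤ p.T * (p.rho c * p.muM) := mul_nonneg hT hρμ
    -- `X` rises by at most `N * qM ≤ rho c * x ≤ rho c * muM` per slot, so its rises and falls obey
    -- the same bound.
    have h6 : E.X t c ω - D ≤ p.T * (p.rho c * p.muM) :=
      h3.trans (mul_le_mul_of_nonneg_left
        (hxq.trans (mul_le_mul_of_nonneg_left hx (hrho c))) hT)
    have h7 : |D - E.X t c ω| ≤ p.T * (p.rho c * p.muM) := abs_le.2 ⟨by linarith, h2⟩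
    have h8 : |(E.R t c ω - x) * p.rho c| ≤ p.rho c * p.muM := by
      rw [abs_mul, abs_of_nonneg (hrho c), mul_comm]
      exact mul_le_mul_of_nonneg_left (abs_le.2 ⟨by linarith, by linarith⟩) (hrho c)
    calc (E.R t c ω - x) * p.rho c * (D - E.X t c ω)
        ≤ |(E.R t c ω - x) * p.rho c| * |D - E.X t c ω| := by
          rw [← abs_mul]; exact le_abs_self _
      _ ≤ (p.rho c * p.muM) * (p.T * (p.rho c * p.muM)) :=
          mul_le_mul h8 h7 (abs_nonneg _) hρμ
      _ = p.rho c ^ 2 * p.muM ^ 2 * p.T := by ring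
  have h5 : (p.qM - p.muM) * E.Us t c ω / p.qM = (p.qM - p.muM) / p.qM * E.Us t c ω := by ring
  rw [h5] at h1
  linarith

lemma servedBacklog_nonneg (hE : FollowsDelayedAlg G p E) (hq : 0 < p.qM) (t : ℕ) (c : Flow)
    (ω : Ω) : 0 ≤ servedBacklog E t c ω := by
  refine Finset.sum_nonneg fun m _ => Finset.sum_nonneg fun n _ => ?_
  by_cases h : E.mu t m n c ω = 0
  · simp [h]
  · have h1 := hE.backlog_lt_of_mu_ne_zero hq h
    have h2 : (E.U t n c ω : ℝ) ≤ E.U t m c ω := by exact_mod_cast h1.le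
    exact mul_nonneg ((hE.link t ω).nonneg m n c) (sub_nonneg.2 h2)

lemma servedBacklog_le (hE : FollowsDelayedAlg G p E) (hmu : 0 ≤ p.muM) (hq : p.muM < p.qM)
    (t : ℕ) (c : Flow) (ω : Ω) :
    servedBacklog E t c ω ≤ (∑ m, ∑ n, E.mu t m n c ω) * p.qM := by
  rw [servedBacklog, Finset.sum_mul]
  refine Finset.sum_le_sum fun m _ => ?_
  rw [Finset.sum_mul]
  refine Finset.sum_le_sum fun n _ => mul_le_mul_of_nonneg_left ?_ ((hE.link t ω).nonneg m n c)
  linarith [hE.U_le hmu hq t m c ω, Nat.cast_nonneg (α := ℝ) (E.U t n c ω)]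

/-- The schedule, based on delayed transport-layer queues, serves the network almost as well as any
admissible rate vector requires. -/
lemma le_sum_scheduled (hE : FollowsDelayedAlg G p E) [Nonempty Flow] (hmu : 1 ≤ p.muM)
    (hq : p.muM < p.qM) {z : Flow → ℝ} (hz : Admissible G z) (hz0 : ∀ c, 0 ≤ z c) (t : ℕ) (ω : Ω) :
    ∑ c, (p.qM - p.muM) / p.qM * (E.Us t c ω * z c)
        - Fintype.card Flow * Fintype.card Node * p.muM * p.T
      ≤ ∑ c, (E.Us t c ω / p.qM * servedBacklog E t c ω
        + E.Us t c ω / p.qM * (p.qM - p.muM - E.U t (G.src c) c ω) * E.adm t c ω) := by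
  have hmu0 : 0 ≤ p.muM := by linarith
  have hq0 : 0 < p.qM := hmu0.trans_lt hq
  have hT : (0 : ℝ) ≤ p.T := Nat.cast_nonneg _
  set D : Flow → ℝ := fun c => delayed p.T (fun s => E.Us s c ω) t with hD
  have hD0 : ∀ c, 0 ≤ D c := fun c => delayed_nonneg (fun s => hE.Us_nonneg s c ω) _ _
  have hl := hE.link t ω
  -- The potential is frozen at this `t` and `ω`, with the same delayed queues that the scheduler
  -- uses.
  have hcap : ∑ c, D c / p.qM * E.U t (G.src c) c ω * z c
      ≤ ∑ c, D c / p.qM * servedBacklog E t c ω := by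
    refine hz.sum_mul_le (κ := fun n c => D c / p.qM * E.U t n c ω)
      (fun n c => mul_nonneg (div_nonneg (hD0 c) hq0.le) (Nat.cast_nonneg _))
      (fun c => by simp [hE.U_dst]) fun g hg => ?_
    have h1 := (hE.schedule t ω).sum_mul_le (fun m n c h => (linkWeight_off_links h).le)
      (fun m c => linkWeight_src.le) hg
    simp only [hg.mul_linkWeight, hl.mul_linkWeight] at h1
    refine h1.trans_eq (Finset.sum_congr rfl fun c _ => ?_)
    rw [servedBacklog, Finset.mul_sum]
    refine Finset.sum_congr rfl fun m _ => ?_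
    rw [Finset.mul_sum]
    refine Finset.sum_congr rfl fun n _ => ?_
    simp only [hD]
    ring
  have hadm : ∀ c, z c * (E.Us t c ω / p.qM * (p.qM - p.muM - E.U t (G.src c) c ω))
      ≤ E.Us t c ω / p.qM * (p.qM - p.muM - E.U t (G.src c) c ω) * E.adm t c ω := by
    intro c
    rw [mul_comm _ (E.adm t c ω)]
    exact (hE.schedule t ω).mul_le_adm_mul c (hz0 c) ((hz.le_one c).trans hmu)
  have hserved : ∀ c, D c / p.qM * servedBacklog E t c ω
      - p.T * p.muM * ∑ m, ∑ n, E.mu t m n c ω ≤ E.Us t c ω / p.qM * servedBacklog E t c ω := by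
    intro c
    have h1 : D c - E.Us t c ω ≤ p.T * p.muM :=
      delayed_sub_le (q := fun t => E.Us t c ω) hmu0 (hE.Us_zero c ω)
        (fun t => hE.le_Us_succ t c ω) p.T t
    have h2 := hE.servedBacklog_nonneg hq0 t c ω
    have h3 := hE.servedBacklog_le hmu0 hq t c ω
    have h4 : (D c - E.Us t c ω) * (servedBacklog E t c ω / p.qM)
        ≤ p.T * p.muM * ∑ m, ∑ n, E.mu t m n c ω :=
      mul_le_mul h1 ((div_le_iff₀ hq0).2 h3) (div_nonneg h2 hq0.le) (mul_nonneg hT hmu0)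
    have h5 : (D c - E.Us t c ω) * (servedBacklog E t c ω / p.qM)
        = D c / p.qM * servedBacklog E t c ω - E.Us t c ω / p.qM * servedBacklog E t c ω := by
      ring
    linarith
  have hsrc : ∀ c, E.Us t c ω / p.qM * E.U t (G.src c) c ω * z c - p.T * p.muM
      ≤ D c / p.qM * E.U t (G.src c) c ω * z c := by
    intro c
    have h1 : E.Us t c ω - D c ≤ p.T * p.muM :=
      sub_delayed_le (q := fun t => E.Us t c ω) hmu0 (hE.Us_zero c ω)
        (fun t => hE.Us_succ_le t c ω) p.T t
    have h2 : (E.U t (G.src c) c ω : ℝ) / p.qM * z c ≤ 1 :=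
      mul_le_one₀ ((div_le_one hq0).2 (hE.U_le hmu0 hq t _ c ω)) (hz0 c) (hz.le_one c)
    have h3 : 0 ≤ (E.U t (G.src c) c ω : ℝ) / p.qM * z c :=
      mul_nonneg (div_nonneg (Nat.cast_nonneg _) hq0.le) (hz0 c)
    have h4 := mul_le_mul h1 h2 h3 (mul_nonneg hT hmu0)
    have h5 : (E.Us t c ω - D c) * ((E.U t (G.src c) c ω : ℝ) / p.qM * z c)
        = E.Us t c ω / p.qM * E.U t (G.src c) c ω * z c
          - D c / p.qM * E.U t (G.src c) c ω * z c := by ring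
    linarith
  have hs1 := Finset.sum_le_sum fun c (_ : c ∈ Finset.univ) => hserved c
  have hs2 := Finset.sum_le_sum fun c (_ : c ∈ Finset.univ) => hsrc c
  have hs3 := Finset.sum_le_sum fun c (_ : c ∈ Finset.univ) => hadm c
  rw [Finset.sum_sub_distrib, ← Finset.mul_sum] at hs1
  rw [Finset.sum_sub_distrib, Finset.sum_const, Finset.card_univ, nsmul_eq_mul] at hs2
  rw [Finset.sum_add_distrib]
  have hs4 : ∑ c, (p.qM - p.muM) / p.qM * (E.Us t c ω * z c)
      = ∑ c, E.Us t c ω / p.qM * E.U t (G.src c) c ω * z c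
        + ∑ c, z c * (E.Us t c ω / p.qM * (p.qM - p.muM - E.U t (G.src c) c ω)) := by
    rw [← Finset.sum_add_distrib]
    exact Finset.sum_congr rfl fun c _ => by ring
  have hcard := two_le_card_node G (Classical.arbitrary Flow)
  have hK : (1 : ℝ) ≤ Fintype.card Flow := by exact_mod_cast Fintype.card_pos
  have hN := hl.two_mul_sum_le
  -- Replacing delayed by current queues costs `T * muM` per flow at the sources and per scheduled
  -- transmission. There are at most `N / 2` transmissions, and `K + N / 2 ≤ K * N` since `K ≥ 1`
  -- and `N ≥ 2`.
  have h6 : Fintype.card Flow + ∑ c, ∑ m, ∑ n, E.mu t m n c ω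
      ≤ (Fintype.card Flow : ℝ) * Fintype.card Node := by nlinarith
  have h7 := mul_le_mul_of_nonneg_left h6 (mul_nonneg hT hmu0)
  linarith

/-- The drift-plus-penalty inequality, pathwise. -/
theorem drift_le (hE : FollowsDelayedAlg G p E) [Nonempty Flow] (hmu : 1 ≤ p.muM)
    (hq : p.muM < p.qM) (ha : ∀ c, 0 ≤ p.a c) (hrho : ∀ c, 0 ≤ p.rho c) {r : Flow → ℝ}
    {ε ε₁ ε' : ℝ} (hr0 : ∀ c, 0 ≤ r c) (hε : 0 < ε) (hr : Admissible G fun c => r c + ε)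
    (hra : ∀ c, p.a c + ε' ≤ r c) (hslack : IsSlack (Fintype.card Node) ε p r ε₁)
    (t : ℕ) (ω : Ω) :
    ∑ c, 1 / 2 * flowEnergy p E (t + 1) c ω - ∑ c, 1 / 2 * flowEnergy p E t c ω
        + min ε₁ ε' * ∑ c, (E.Us t c ω + E.X t c ω + E.Z t c ω)
      ≤ constB3 (Fintype.card Node) (Fintype.card Flow) p
        + p.V * (∑ c, E.R t c ω - ∑ c, r c) := by
  have hmu0 : 0 ≤ p.muM := by linarith
  have hq0 : 0 < p.qM := hmu0.trans_lt hq
  obtain ⟨hε₁, hs1, hs2⟩ := hslack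
  set N : ℝ := (Fintype.card Node : ℝ) with hN
  set K : ℝ := (Fintype.card Flow : ℝ) with hK
  have hN0 : 0 ≤ N := Nat.cast_nonneg _
  have hT : (0 : ℝ) ≤ p.T := Nat.cast_nonneg _
  -- So `r c` is a rate that the congestion controller could have chosen.
  have hr1 : ∀ c, r c ≤ p.muM := fun c => by
    have := hr.le_one c
    linarith
  have hflow : ∀ c, 1 / 2 * flowEnergy p E (t + 1) c ω - 1 / 2 * flowEnergy p E t c ω
      + min ε₁ ε' * (E.Us t c ω + E.X t c ω + E.Z t c ω)
      ≤ 1 / 2 * N * p.qM * p.muM + (p.qM - p.muM) / p.qM * p.muM ^ 2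
        + 1 / 2 * p.muM ^ 2 * p.rho c ^ 2 + 1 / 2 * N ^ 2 * p.qM ^ 2
        + 1 / 2 * p.muM ^ 2 + 1 / 2 * p.a c ^ 2 + p.rho c ^ 2 * (p.muM ^ 2 * p.T)
        + p.V * (E.R t c ω - r c) + (p.qM - p.muM) / p.qM * (E.Us t c ω * (r c + ε))
        - (E.Us t c ω / p.qM * servedBacklog E t c ω
          + E.Us t c ω / p.qM * (p.qM - p.muM - E.U t (G.src c) c ω) * E.adm t c ω) := by
    intro c
    have h1 := hE.flowEnergy_succ_le hmu0 hq ha hrho t c ω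
    have h2 := hE.congestion_le hmu0 hq hrho t c ω (hr0 c) (hr1 c) (by linarith [hs1 c])
    rw [← hN] at h1
    have hU0 := hE.Us_nonneg t c ω
    have hX0 := hE.X_nonneg t c ω
    have hZ0 := hE.Z_nonneg ha t c ω
    have h3 := mul_le_mul_of_nonneg_left ((min_le_left ε₁ ε').trans hs2) hU0
    have h4 : min ε₁ ε' ≤ p.rho c * r c - ∑ n, (E.U t n c ω : ℝ) := by
      linarith [min_le_left ε₁ ε', hs1 c, hE.sum_U_le hmu0 hq t c ω]
    have h5 := mul_le_mul_of_nonneg_left h4 hX0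
    have h6 := mul_le_mul_of_nonneg_left
      (show min ε₁ ε' ≤ r c - p.a c by linarith [min_le_right ε₁ ε', hra c]) hZ0
    have h7 : E.Us t c ω * ((ε * (p.qM - p.muM) - (2 * N - 1 + p.muM ^ 2) / 2) / p.qM)
        = (p.qM - p.muM) / p.qM * (E.Us t c ω * ε)
          - E.Us t c ω / p.qM * ((2 * N - 1 + p.muM ^ 2) / 2) := by ring
    have h8 : E.Us t c ω / p.qM * (p.qM - p.muM - E.U t (G.src c) c ω) * E.adm t c ω
        = (p.qM - p.muM) / p.qM * (E.Us t c ω * E.adm t c ω)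
          - E.Us t c ω / p.qM * (E.U t (G.src c) c ω * E.adm t c ω) := by ring
    rw [h7] at h3
    rw [h8]
    linarith
  have hsum := Finset.sum_le_sum fun c (_ : c ∈ Finset.univ) => hflow c
  have hsched := hE.le_sum_scheduled hmu hq hr (fun c => by linarith [hr0 c]) t ω
  -- This summand of `constB3` is pure slack: the estimate of the delay error in `X` does not need
  -- it.
  have hsup : 0 ≤ N * p.qM * p.T * p.muM * ⨆ c, p.rho c := by
    have := Real.iSup_nonneg hrho
    positivity
  have hKa : ∑ c, p.a c ^ 2 ≤ K * ∑ c, p.a c ^ 2 := by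
    have hK1 : 1 ≤ K := by rw [hK]; exact_mod_cast Fintype.card_pos
    exact le_mul_of_one_le_left (Finset.sum_nonneg fun c _ => sq_nonneg _) hK1
  rw [← hN, ← hK] at hsched
  simp only [Finset.sum_add_distrib, Finset.sum_sub_distrib, ← Finset.mul_sum, ← Finset.sum_mul,
    Finset.sum_const, Finset.card_univ, nsmul_eq_mul, ← hK] at hsum hsched ⊢
  unfold constB3 constB
  linarith

end FollowsDelayedAlg

end MultiHop

/-! ### Time averages and the integrated drift inequality. -/

namespace MultiHop

lemma limsup_timeAvg_le {f : ℕ → ℝ} {b : ℝ}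
    (h : ∀ y, b < y → ∀ᶠ t : ℕ in atTop, (∑ τ ∈ Finset.range t, f τ) / t ≤ y) :
    limsup (timeAvg f) atTop ≤ (b : EReal) := by
  refine EReal.le_of_forall_lt_iff_le.1 fun y hy => ?_
  refine limsup_le_of_le (h := ?_)
  filter_upwards [h y (by exact_mod_cast hy)] with t ht
  exact EReal.coe_le_coe_iff.2 ht

lemma eventually_div_lt_of_limsup_timeAvg_le {f : ℕ → ℝ} {b y : ℝ}
    (h : limsup (timeAvg f) atTop ≤ (b : EReal)) (hy : b < y) :
    ∀ᶠ t : ℕ in atTop, (∑ τ ∈ Finset.range t, f τ) / t < y := by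
  filter_upwards [eventually_lt_of_limsup_lt (h.trans_lt (EReal.coe_lt_coe_iff.2 hy))] with t ht
  exact EReal.coe_lt_coe_iff.1 ht

lemma le_liminf_timeAvg {f : ℕ → ℝ} {b : ℝ}
    (h : ∀ᶠ t : ℕ in atTop, b ≤ (∑ τ ∈ Finset.range t, f τ) / t) :
    (b : EReal) ≤ liminf (timeAvg f) atTop := by
  refine le_liminf_of_le (h := ?_)
  filter_upwards [h] with t ht
  exact EReal.coe_le_coe_iff.2 ht

variable {Node Flow : Type*} [Fintype Node] [DecidableEq Node] [Fintype Flow]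

namespace FollowsDelayedAlg

variable {Ω : Type*} [MeasurableSpace Ω] {G : Network Node Flow} {p : Params Flow}
  {E : Evolution Node Flow Ω}

/-- The drift-plus-penalty inequality, summed over time and averaged over the sample space. -/
theorem sum_integral_le (hE : FollowsDelayedAlg G p E) [Nonempty Flow] (P : Measure Ω)
    [IsProbabilityMeasure P] (hmu : 1 ≤ p.muM)
    (hq : p.muM < p.qM) (ha : ∀ c, 0 ≤ p.a c) (hrho : ∀ c, 0 ≤ p.rho c) {r : Flow → ℝ}
    {ε ε₁ ε' : ℝ} (hr0 : ∀ c, 0 ≤ r c) (hε : 0 < ε) (hr : Admissible G fun c => r c + ε)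
    (hra : ∀ c, p.a c + ε' ≤ r c) (hslack : IsSlack (Fintype.card Node) ε p r ε₁) (t : ℕ) :
    min ε₁ ε' * ∑ τ ∈ Finset.range t, ∑ c, ∫ ω, (E.Us τ c ω + E.X τ c ω + E.Z τ c ω) ∂P
      ≤ t * (constB3 (Fintype.card Node) (Fintype.card Flow) p - p.V * ∑ c, r c)
        + p.V * ∑ τ ∈ Finset.range t, ∑ c, ∫ ω, E.R τ c ω ∂P := by
  have hmu0 : 0 ≤ p.muM := by linarith
  have hpath : ∀ ω, min ε₁ ε' * ∑ τ ∈ Finset.range t, ∑ c, (E.Us τ c ω + E.X τ c ω + E.Z τ c ω)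
      ≤ t * (constB3 (Fintype.card Node) (Fintype.card Flow) p - p.V * ∑ c, r c)
        + p.V * ∑ τ ∈ Finset.range t, ∑ c, E.R τ c ω := by
    intro ω
    have h1 : ∑ c, 1 / 2 * flowEnergy p E t c ω
        + min ε₁ ε' * ∑ τ ∈ Finset.range t, ∑ c, (E.Us τ c ω + E.X τ c ω + E.Z τ c ω)
        ≤ t * (constB3 (Fintype.card Node) (Fintype.card Flow) p - p.V * ∑ c, r c)
          + p.V * ∑ τ ∈ Finset.range t, ∑ c, E.R τ c ω := by
      induction t with
      | zero => simp [flowEnergy, hE.Us_zero, hE.X_zero, hE.Z_zero]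
      | succ t ih =>
        have h2 := hE.drift_le hmu hq ha hrho hr0 hε hr hra hslack t ω
        rw [Finset.sum_range_succ, Finset.sum_range_succ]
        push_cast
        linarith
    have h3 : 0 ≤ ∑ c, 1 / 2 * flowEnergy p E t c ω := Finset.sum_nonneg fun c _ =>
      mul_nonneg (by norm_num) (hE.flowEnergy_nonneg hmu0 hq t c ω)
    linarith
  have hiR : ∀ τ ∈ Finset.range t, ∀ c ∈ Finset.univ, Integrable (fun ω => E.R τ c ω) P :=
    fun τ _ c _ => hE.integrable_R P τ c
  have hiQ : ∀ τ ∈ Finset.range t, ∀ c ∈ Finset.univ,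
      Integrable (fun ω => E.Us τ c ω + E.X τ c ω + E.Z τ c ω) P :=
    fun τ _ c _ => ((hE.integrable_Us P τ c).add (hE.integrable_X P hmu0 hq hrho τ c)).add
      (hE.integrable_Z P ha τ c)
  have hiR' := integrable_finsetSum _ fun τ hτ => integrable_finsetSum _ (hiR τ hτ)
  have hiQ' := integrable_finsetSum _ fun τ hτ => integrable_finsetSum _ (hiQ τ hτ)
  have h1 := integral_mono (μ := P) (hiQ'.const_mul (min ε₁ ε'))
    ((integrable_const _).add (hiR'.const_mul p.V)) hpath
  simp only [Pi.add_apply] at h1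
  rw [integral_add (integrable_const _) (hiR'.const_mul p.V), integral_const_mul,
    integral_const_mul, integral_const_mul, integral_const, probReal_univ, one_smul,
    integral_finsetSum _ fun τ hτ => integrable_finsetSum _ (hiR τ hτ),
    integral_finsetSum _ fun τ hτ => integrable_finsetSum _ (hiQ τ hτ),
    Finset.sum_congr rfl fun τ hτ => integral_finsetSum _ (hiR τ hτ),
    Finset.sum_congr rfl fun τ hτ => integral_finsetSum _ (hiQ τ hτ)] at h1
  exact h1

lemma sum_integral_R_le (hE : FollowsDelayedAlg G p E) (P : Measure Ω) [IsProbabilityMeasure P]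
    (t : ℕ) : ∑ c, ∫ ω, E.R t c ω ∂P ≤ Fintype.card Flow * p.muM := by
  refine (Finset.sum_le_sum fun c _ => ?_).trans_eq (b := ∑ _c : Flow, p.muM) (by simp)
  refine (integral_mono (hE.integrable_R P t c) (integrable_const p.muM) (hE.R_le t c)).trans_eq ?_
  simp

end FollowsDelayedAlg

end MultiHop

theorem theorem4 {Node Flow : Type*} [Fintype Node] [DecidableEq Node] [Fintype Flow]
    [Nonempty Flow] {Ω : Type*} [MeasurableSpace Ω] (P : Measure Ω) [IsProbabilityMeasure P]
    (G : MultiHop.Network Node Flow) (p : MultiHop.Params Flow)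
    (N K : ℝ) (hN : N = Fintype.card Node) (hK : K = Fintype.card Flow)
    (ε ε' : ℝ) (r : Flow → ℝ)
    (hmuM : 1 ≤ p.muM) (hV : 0 < p.V) (ha : ∀ c, 0 ≤ p.a c) (hε : 0 < ε)
    (hr : MultiHop.IsEpsOptimal G p.a ε r)
    (hε' : 0 < ε') (hra : ∀ c, p.a c + ε' ≤ r c)
    (hqM : (2 * N - 1 + p.muM ^ 2) / (2 * ε) + p.muM < p.qM)
    (hrho : ∀ c, N * p.qM / r c < p.rho c)
    (E : MultiHop.Evolution Node Flow Ω) (hE : MultiHop.FollowsDelayedAlg G p E) :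
    -- all the expectations exist
    (∀ t c, Integrable (E.R t c) P ∧ Integrable (E.Us t c) P ∧ Integrable (E.X t c) P ∧
      Integrable (E.Z t c) P) ∧
    -- the time-averaged bound of the virtual queues
    limsup (MultiHop.timeAvg fun t => ∑ c, ∫ ω, E.R t c ω ∂P) atTop ≤ ((K * p.muM : ℝ) : EReal) ∧
    (∃ ε₁, MultiHop.IsSlack N ε p r ε₁) ∧
    (∀ ε₁ BR : ℝ, MultiHop.IsSlack N ε p r ε₁ →
      limsup (MultiHop.timeAvg fun t => ∑ c, ∫ ω, E.R t c ω ∂P) atTop ≤ (BR : EReal) →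
      limsup (MultiHop.timeAvg fun t => ∑ c, ∫ ω, (E.Us t c ω + E.X t c ω + E.Z t c ω) ∂P) atTop
        ≤ (((MultiHop.constB3 N K p + p.V * BR) / min ε₁ ε' : ℝ) : EReal)) ∧
    -- the throughput
    (((∑ c, r c) - MultiHop.constB3 N K p / p.V : ℝ) : EReal)
      ≤ liminf (MultiHop.timeAvg fun t => ∑ c, ∫ ω, E.R t c ω ∂P) atTop := by
  subst hN hK
  obtain ⟨c₀⟩ := ‹Nonempty Flow›
  have hne : Nonempty Flow := ⟨c₀⟩
  have hN2 := MultiHop.two_le_card_node G c₀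
  have hr0 : ∀ c, 0 < r c := fun c => by linarith [ha c, hra c]
  have hgap : 0 < 2 * (Fintype.card Node : ℝ) - 1 + p.muM ^ 2 := by nlinarith
  have hq : p.muM < p.qM := by
    have : 0 < (2 * (Fintype.card Node : ℝ) - 1 + p.muM ^ 2) / (2 * ε) := by positivity
    linarith
  have hq0 : 0 < p.qM := by linarith
  have hrho0 : ∀ c, 0 ≤ p.rho c := fun c => by
    have : 0 ≤ (Fintype.card Node : ℝ) * p.qM / r c :=
      div_nonneg (mul_nonneg (Nat.cast_nonneg _) hq0.le) (hr0 c).le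
    linarith [hrho c]
  have hslack : ∃ ε₁, MultiHop.IsSlack (Fintype.card Node) ε p r ε₁ := by
    obtain ⟨c₁, hc₁⟩ := Finite.exists_min fun c => p.rho c * r c - Fintype.card Node * p.qM
    refine ⟨min (p.rho c₁ * r c₁ - Fintype.card Node * p.qM) ((ε * (p.qM - p.muM)
      - (2 * (Fintype.card Node : ℝ) - 1 + p.muM ^ 2) / 2) / p.qM), lt_min ?_ ?_,
      fun c => (min_le_left _ _).trans (hc₁ c), min_le_right _ _⟩
    · have := hrho c₁
      rw [div_lt_iff₀ (hr0 c₁)] at this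
      linarith
    · have h1 := lt_sub_iff_add_lt.2 hqM
      rw [div_lt_iff₀ (by positivity)] at h1
      exact div_pos (by linarith) hq0
  have hmain : ∀ ε₁, MultiHop.IsSlack (Fintype.card Node) ε p r ε₁ → ∀ t, _ :=
    fun ε₁ h₁ t => hE.sum_integral_le P hmuM hq ha hrho0 (fun c => (hr0 c).le) hε hr.mem hra h₁ t
  refine ⟨fun t c => ⟨hE.integrable_R P t c, hE.integrable_Us P t c,
    hE.integrable_X P (by linarith) hq hrho0 t c, hE.integrable_Z P ha t c⟩, ?_, hslack, ?_, ?_⟩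
  · refine MultiHop.limsup_timeAvg_le fun y hy => ?_
    filter_upwards [eventually_gt_atTop 0] with t ht
    rw [div_le_iff₀ (by exact_mod_cast ht)]
    refine (Finset.sum_le_sum fun τ _ => hE.sum_integral_R_le P τ).trans ?_
    rw [Finset.sum_const, Finset.card_range, nsmul_eq_mul, mul_comm]
    exact mul_le_mul_of_nonneg_right hy.le (Nat.cast_nonneg _)
  · intro ε₁ BR h₁ hBR
    have hδ : 0 < min ε₁ ε' := lt_min h₁.1 hε'
    refine MultiHop.limsup_timeAvg_le fun y hy => ?_
    rw [div_lt_iff₀ hδ] at hy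
    -- The threshold is the average input rate at which `B₃ + V * rate` equals `y * min ε₁ ε'`; the
    -- term `-V * ∑ r` is discarded.
    have hy' : BR < (y * min ε₁ ε'
        - MultiHop.constB3 (Fintype.card Node) (Fintype.card Flow) p) / p.V := by
      rw [lt_div_iff₀ hV]
      linarith
    filter_upwards [MultiHop.eventually_div_lt_of_limsup_timeAvg_le hBR hy',
      eventually_gt_atTop 0] with t ht h0
    have h0' : (0 : ℝ) < t := by exact_mod_cast h0
    rw [div_lt_div_iff₀ h0' hV] at ht
    rw [div_le_iff₀ h0']
    have h2 := hmain ε₁ h₁ t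
    have h3 : 0 ≤ ∑ c, r c := Finset.sum_nonneg fun c _ => (hr0 c).le
    have h4 : 0 ≤ t * (p.V * ∑ c, r c) := by positivity
    refine le_of_mul_le_mul_left ?_ hδ
    linarith
  · obtain ⟨ε₁, h₁⟩ := hslack
    refine MultiHop.le_liminf_timeAvg ?_
    filter_upwards [eventually_gt_atTop 0] with t h0
    have h0' : (0 : ℝ) < t := by exact_mod_cast h0
    have h2 := hmain ε₁ h₁ t
    have hδ : 0 < min ε₁ ε' := lt_min h₁.1 hε'
    have h3 : 0 ≤ ∑ τ ∈ Finset.range t, ∑ c, ∫ ω, (E.Us τ c ω + E.X τ c ω + E.Z τ c ω) ∂P :=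
      Finset.sum_nonneg fun τ _ => Finset.sum_nonneg fun c _ => integral_nonneg fun ω =>
        add_nonneg (add_nonneg (hE.Us_nonneg τ c ω) (hE.X_nonneg τ c ω)) (hE.Z_nonneg ha τ c ω)
    -- For the throughput the queue sum is discarded, being nonnegative, and every `t > 0` satisfies
    -- the bound.
    have h4 := h2.trans' (mul_nonneg hδ.le h3)
    rw [le_div_iff₀ h0']
    refine le_of_mul_le_mul_left ?_ hV
    have h5 : p.V * ((∑ c, r c - MultiHop.constB3 (Fintype.card Node) (Fintype.card Flow) p / p.V)
        * t) = t * (p.V * ∑ c, r c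
          - MultiHop.constB3 (Fintype.card Node) (Fintype.card Flow) p) := by
      field_simp
    linarith
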